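/- Let $A\subset\mathbb R^2$ be a finite point set with no three points on a common line, and let $\omega:A\to\mathbb R$ be a height function. A triangulation of $A$ is a geometric simplicial complex with vertices in $A$ (not necessarily all of $A$) and underlying space $\operatorname{conv}(A)$. For a simplex with vertex set $s\subseteq A$, its lift is the simplex in $\mathbb R^3$ with vertices $(p,\omega(p))$, $p\in s$. Let $\mathcal T_u,\mathcal T_v$ be triangulations of $A$ and let $\mathcal T_u^\omega,\mathcal T_v^\omega$ be the complexes of lifted simplices. Their underlying spaces are graphs of piecewise linear functions $g_u,g_v:\operatorname{conv}(A)\to\mathbb R$. Assume that $g_u\le g_v$ and that the two graphs meet only over the boundary of $\operatorname{conv}(A)$. Let $P_{uv}=\{(x,z): x\in\operatorname{conv}(A),\ g_u(x)\le z\le g_v(x)\}$ be the polyhedron with lower faces $\mathcal T_u^\omega$ and upper faces $\mathcal T_v^\omega$, and let $\mathcal T_{uv}$ be a Steiner-free triangulation of $P_{uv}$: a geometric simplicial complex in $\mathbb R^3$ with underlying space $P_{uv}$, whose vertices are exactly those of $\mathcal T_u^\omega$ and $\mathcal T_v^\omega$, and which contains the simplices of $\mathcal T_u^\omega$ and $\mathcal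 T_v^\omega$. A tetrahedron $s$ of $\mathcal T_{uv}$ is in front of a different tetrahedron $t$, seen from $(0,0,-\infty)$ (respectively $(0,0,+\infty)$), if some upward (respectively downward) vertical ray meets first $s$ and then $t$. Below, vertices in $\mathbb R^3$ are identified with their projections to the plane. Given a set $\mathcal T$ of triangles in the plane, a face of a tetrahedron $t$ is exposed if it is in $\mathcal T$. The tetrahedron $t$ is removable if (1) exactly one face is exposed and the fourth vertex lies in its interior in the plane, or (2) exactly two faces are exposed and the four vertices form a strictly convex quadrilateral in the plane, or (3) exactly three faces are exposed. The corresponding flip replaces in $\mathcal T$ the exposed faces of $t$ by its other faces. The tetrahedra-driven flip algorithm starts with $\mathcal T:=\mathcal T_u$ (its set of triangles), $\mathcal Q:=$ the set of all tetrahedra of $\mathcal T_{uv}$, and the empty list $\mathcal L$. While $\mathcal Q\ne\emptyset$ it does the following: if there is a removable tetrahedron in $\mathcal Q$, it chooses any such $t$, deletes it from $\mathcal Q$, performs the corresponding flip in $\mathcal T$ and appends $t$ to $\mathcal L$; otherwise it leaves everything unchanged (and so runs forever). For triangulations $\mathcal T_1,\mathcal T_2$ of $A$, the passage from $\mathcal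 T_1$ to $\mathcal T_2$ is an up-flip supported by four points of $A$ if the lift of these points is a non-degenerate tetrahedron, all of its lower faces (projected) are triangles of $\mathcal T_1$, and the triangles of $\mathcal T_2$ arise from those of $\mathcal T_1$ by replacing these lower faces by the upper faces. For a down-flip the roles of the lower and upper faces are exchanged. **Theorem.** Suppose that $\mathcal T_{uv}$ contains no cycle of tetrahedra in the in-front relation seen from $(0,0,-\infty)$ (or from $(0,0,+\infty)$). Then every execution of the algorithm terminates. On termination $\mathcal T$ is $\mathcal T_v$, the list $\mathcal L$ contains every tetrahedron of $\mathcal T_{uv}$ exactly once, and the successive values of $\mathcal T$ are (the sets of triangles of) triangulations of $A$ that form a monotone sequence of up-flips from $\mathcal T_u$ to $\mathcal T_v$, the $i$-th flip being supported by the $i$-th tetrahedron of $\mathcal L$. Likewise, every execution started at $\mathcal T:=\mathcal T_v$ terminates with $\mathcal T_u$, the list $\mathcal L$ contains every tetrahedron of $\mathcal T_{uv}$ exactly once, and the successive values of $\mathcal T$ form in the same way a monotone sequence of down-flips from $\mathcal T_v$ to $\mathcal T_u$. -/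

import Mathlib

open Geometry

/-- The Euclidean plane. -/
abbrev Plane : Type := EuclideanSpace ℝ (Fin 2)

/-- Three-dimensional space, written as plane times height axis. The canonical projection is
`Prod.fst`; only the affine structure is used. -/
abbrev Space : Type := Plane × ℝ

/-- The two types of directed flips. -/
inductive Direction : Type
  | up : Direction
  | down : Direction

/-- No three points of `A` lie on a common line. -/
def InGeneralPosition (A : Finset Plane) : Prop :=
  ∀ a ∈ A, ∀ b ∈ A, ∀ c ∈ A, a ≠ b → a ≠ c → b ≠ c → ¬ Collinear ℝ {a, b, c}

/-- `T` is a triangulation of the planar point set `A`: a geometric simplicial complex with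
vertices in `A` (not necessarily all of `A`) whose underlying space is `conv A`. -/
def IsTriangulation (A : Finset Plane) (T : SimplicialComplex ℝ Plane) : Prop :=
  T.vertices ⊆ (A : Set Plane) ∧ T.space = convexHull ℝ (A : Set Plane)

/-- The triangles (2-simplices) of a planar complex. -/
def triangles (T : SimplicialComplex ℝ Plane) : Set (Finset Plane) :=
  {f | f ∈ T.faces ∧ f.card = 3}

/-- The lifting map `p ↦ (p, ω p)`. Only the heights of points of the given set `A` matter. -/
def liftMap (ω : Plane → ℝ) : Plane ↪ Space where
  toFun p := (p, ω p)
  inj' _ _ h := congrArg Prod.fst h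

/-- The vertex set of the lifted simplex with planar vertex set `s`. -/
def liftSimplex (ω : Plane → ℝ) (s : Finset Plane) : Finset Space :=
  s.map (liftMap ω)

/-- The characteristic section of `T` as a surface in space: the union of all simplices of the
lifted triangulation of `T`. -/
def charSection (ω : Plane → ℝ) (T : SimplicialComplex ℝ Plane) : Set Space :=
  ⋃ s ∈ T.faces, convexHull ℝ (liftSimplex ω s : Set Space)

/-- The lifted triangulation of `T₁` lies vertically below that of `T₂`. -/
def LiesBelow (ω : Plane → ℝ) (T₁ T₂ : SimplicialComplex ℝ Plane) : Prop :=
  ∀ x : Plane, ∀ z₁ z₂ : ℝ,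
    (x, z₁) ∈ charSection ω T₁ → (x, z₂) ∈ charSection ω T₂ → z₁ ≤ z₂

/-- The two characteristic sections meet only along their boundary, that is, only over the
boundary of `conv A`. -/
def MeetOnlyAtBoundary (ω : Plane → ℝ) (A : Finset Plane)
    (T₁ T₂ : SimplicialComplex ℝ Plane) : Prop :=
  ∀ q ∈ charSection ω T₁ ∩ charSection ω T₂, q.1 ∈ frontier (convexHull ℝ (A : Set Plane))

/-- The solid polyhedron bounded from below by the lifted triangulation of `Tu` and from above by
the lifted triangulation of `Tv`. -/
def polyhedronBetween (ω : Plane → ℝ) (Tu Tv : SimplicialComplex ℝ Plane) : Set Space :=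
  {q | ∃ z₁ z₂ : ℝ, (q.1, z₁) ∈ charSection ω Tu ∧ (q.1, z₂) ∈ charSection ω Tv ∧
    z₁ ≤ q.2 ∧ q.2 ≤ z₂}

/-- `K` is a Steiner-free triangulation of the polyhedron whose lower faces are the lifted
triangles of `Tu` and whose upper faces are the lifted triangles of `Tv`: it fills the polyhedron,
it has the faces of the polyhedron among its simplices, and its vertices are exactly the vertices
of the polyhedron. -/
structure IsSteinerFreeTetrahedralisation (ω : Plane → ℝ) (Tu Tv : SimplicialComplex ℝ Plane)
    (K : SimplicialComplex ℝ Space) : Prop where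
  space_eq : K.space = polyhedronBetween ω Tu Tv
  lower_faces : ∀ s ∈ Tu.faces, liftSimplex ω s ∈ K.faces
  upper_faces : ∀ s ∈ Tv.faces, liftSimplex ω s ∈ K.faces
  vertices_eq : K.vertices = liftMap ω '' (Tu.vertices ∪ Tv.vertices)

/-- The tetrahedra of `K`, each recorded by the planar projection of its four vertices. -/
def tetrahedra (ω : Plane → ℝ) (K : SimplicialComplex ℝ Space) : Set (Finset Plane) :=
  {t | t.card = 4 ∧ liftSimplex ω t ∈ K.faces}

/-! ### Directed flips -/

/-- `f` is a lower face of the lifted tetrahedron on `t`: the non-vertical plane through the lifted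
`f` (the graph of `h`) has the remaining lifted vertex strictly above it. -/
def IsLowerFace (ω : Plane → ℝ) (t f : Finset Plane) : Prop :=
  f ⊆ t ∧ f.card = 3 ∧ ∃ h : Plane →ᵃ[ℝ] ℝ,
    (∀ p ∈ f, h p = ω p) ∧ ∀ p ∈ t, p ∉ f → h p < ω p

/-- `f` is an upper face of the lifted tetrahedron on `t`. -/
def IsUpperFace (ω : Plane → ℝ) (t f : Finset Plane) : Prop :=
  f ⊆ t ∧ f.card = 3 ∧ ∃ h : Plane →ᵃ[ℝ] ℝ,
    (∀ p ∈ f, h p = ω p) ∧ ∀ p ∈ t, p ∉ f → ω p < h p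

/-- The faces of the tetrahedron that a flip in the given direction removes. -/
def IsOldFace : Direction → (Plane → ℝ) → Finset Plane → Finset Plane → Prop
  | .up => IsLowerFace
  | .down => IsUpperFace

/-- The faces of the tetrahedron that a flip in the given direction creates. -/
def IsNewFace : Direction → (Plane → ℝ) → Finset Plane → Finset Plane → Prop
  | .up => IsUpperFace
  | .down => IsLowerFace

/-- The triangulation `T₂` of `A` arises from the triangulation `T₁` of `A` by a flip in direction
`dir` whose four supporting points are `t`. For an up-flip the lower faces of the lifted
tetrahedron on `t` are triangles of `T₁` and are replaced by its upper faces; for a down-flip it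
is the other way around. -/
structure IsDirectedFlip (dir : Direction) (ω : Plane → ℝ) (A t : Finset Plane)
    (T₁ T₂ : SimplicialComplex ℝ Plane) : Prop where
  source : IsTriangulation A T₁
  target : IsTriangulation A T₂
  support : t ⊆ A
  card_eq : t.card = 4
  nondegenerate : AffineIndependent ℝ ((↑) : {q // q ∈ liftSimplex ω t} → Space)
  old_mem : ∀ f, IsOldFace dir ω t f → f ∈ triangles T₁
  triangles_eq : triangles T₂ =
    (triangles T₁ \ {f | IsOldFace dir ω t f}) ∪ {f | IsNewFace dir ω t f}

/-! ### The in-front/behind relation -/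

/-- Seen from a viewpoint at infinity on the vertical axis, `s` is in front of `t`: some
vertical ray from that viewpoint (`(0,0,-∞)` when looking `up`, `(0,0,+∞)` when looking `down`)
meets first the lifted tetrahedron on `s` and then the different lifted tetrahedron on `t`. -/
def InFront (look : Direction) (ω : Plane → ℝ) (s t : Finset Plane) : Prop :=
  s ≠ t ∧ ∃ (x : Plane) (z z' : ℝ),
    (x, z) ∈ convexHull ℝ (liftSimplex ω s : Set Space) ∧
    (x, z') ∈ convexHull ℝ (liftSimplex ω t : Set Space) ∧
    match look with
    | .up => z < z'
    | .down => z' < z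

/-- No cycle of tetrahedra of `K` in the in-front/behind relation. -/
def HasNoCycle (look : Direction) (ω : Plane → ℝ) (K : SimplicialComplex ℝ Space) : Prop :=
  ∀ t, ¬ Relation.TransGen
    (fun s s' => s ∈ tetrahedra ω K ∧ s' ∈ tetrahedra ω K ∧ InFront look ω s s') t t

/-! ### The tetrahedra-driven flip algorithm -/

/-- The three-element faces of `t` that are exposed in the set `𝒯` of triangles. -/
def exposedFaces (𝒯 : Set (Finset Plane)) (t : Finset Plane) : Set (Finset Plane) :=
  {f | f ⊆ t ∧ f.card = 3 ∧ f ∈ 𝒯}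

/-- The three-element faces of `t` that are missing in the set `𝒯` of triangles. -/
def missingFaces (𝒯 : Set (Finset Plane)) (t : Finset Plane) : Set (Finset Plane) :=
  {f | f ⊆ t ∧ f.card = 3 ∧ f ∉ 𝒯}

/-- Removability of a tetrahedron: one exposed face containing the (projection of the) fourth vertex
in its interior (1-3 flip), two exposed faces of a strictly convex quadrilateral (2-2 flip), or
three exposed faces (3-1 flip). -/
def Removable (𝒯 : Set (Finset Plane)) (t : Finset Plane) : Prop :=
  ((exposedFaces 𝒯 t).ncard = 1 ∧ ∀ f ∈ exposedFaces 𝒯 t, ∀ d ∈ t, d ∉ f →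
      d ∈ interior (convexHull ℝ (f : Set Plane))) ∨
  ((exposedFaces 𝒯 t).ncard = 2 ∧ ConvexIndependent ℝ ((↑) : {p // p ∈ t} → Plane)) ∨
  (exposedFaces 𝒯 t).ncard = 3

/-- The flip of the algorithm: exposed faces of `t` are replaced by the missing ones. -/
def performFlip (𝒯 : Set (Finset Plane)) (t : Finset Plane) : Set (Finset Plane) :=
  (𝒯 \ exposedFaces 𝒯 t) ∪ missingFaces 𝒯 t

/-- A state of the algorithm: the triangles of the current planar triangulation, the set `queue` of
tetrahedra still to be removed, and the list `output` of tetrahedra removed so far. -/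
structure AlgState : Type where
  current : Set (Finset Plane)
  queue : Set (Finset Plane)
  output : List (Finset Plane)

/-- One execution of the body of the while loop. Any removable tetrahedron of the queue may be
chosen; if there is none, the body does nothing. -/
def LoopBody (S S' : AlgState) : Prop :=
  (∃ t ∈ S.queue, Removable S.current t ∧
    S' = ⟨performFlip S.current t, S.queue \ {t}, S.output ++ [t]⟩) ∨
  ((∀ t ∈ S.queue, ¬ Removable S.current t) ∧ S' = S)

/-- `S` is the sequence of states of an execution of the algorithm with inputs `K` and `T`. The
execution has terminated as soon as the queue is empty; if it gets stuck, it loops forever. -/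
def IsRun (ω : Plane → ℝ) (K : SimplicialComplex ℝ Space) (T : SimplicialComplex ℝ Plane)
    (S : ℕ → AlgState) : Prop :=
  S 0 = ⟨triangles T, tetrahedra ω K, []⟩ ∧
  ∀ n, ((S n).queue.Nonempty → LoopBody (S n) (S (n + 1))) ∧
    ((S n).queue = ∅ → S (n + 1) = S n)

/-- Every execution of the algorithm on `K`, started at the triangulation `T`, terminates after
finitely many iterations with the triangulation `T'`; its output lists every tetrahedron of `K`
exactly once; and the intermediate states are triangulations of `A` forming a sequence of flips,
all of direction `dir`, from `T` to `T'`, the flips being given by the listed tetrahedra in order.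
-/
def AlgorithmSucceeds (dir : Direction) (ω : Plane → ℝ) (A : Finset Plane)
    (K : SimplicialComplex ℝ Space) (T T' : SimplicialComplex ℝ Plane) : Prop :=
  ∀ S : ℕ → AlgState, IsRun ω K T S →
    ∃ N : ℕ, (S N).queue = ∅ ∧ (S N).current = triangles T' ∧
      (S N).output.length = N ∧ (S N).output.Nodup ∧
      (∀ t, t ∈ (S N).output ↔ t ∈ tetrahedra ω K) ∧
      ∃ Ts : ℕ → SimplicialComplex ℝ Plane, Ts 0 = T ∧ Ts N = T' ∧
        (∀ i ≤ N, IsTriangulation A (Ts i) ∧ (S i).current = triangles (Ts i)) ∧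
        ∀ (i : ℕ) (hi : i < (S N).output.length),
          IsDirectedFlip dir ω A ((S N).output[i]) (Ts i) (Ts (i + 1))

/-! The algorithm sweeps the polyhedron with a rising section. The invariant `Front` says that the
current triangulation consists of faces of the filling, that every queued tetrahedron lies weakly
above its lift, and that generic points strictly between this lift and the upper boundary lie in
queued tetrahedra.

Hence an exposed face of a queued tetrahedron can only be a lower face (`Front.pos_of_exposed`), and
counting in the three cases of `Removable` forces all lower faces to be exposed
(`IsCircuit.exposed_of_removable`). So every choice open to the algorithm is a genuine flip, and it
preserves the invariant (`Tri.flip`, `Front.flip`). Acyclicity is needed only for progress: a queued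
tetrahedron that is minimal in the in-front order has all its lower faces exposed
(`Front.exposed_of_pos`) and is therefore removable (`IsCircuit.removable`). Each flip shrinks the
queue. Once it is empty, no room is left below the upper boundary, and the section has reached it
(`Front.eq_of_queue_empty`).

All geometry is done with barycentric weights on `A` and the linear functionals `mass`, `pt` and
`ht`. The vertices of a tetrahedron carry an affine dependence `l` (`IsCircuit`) of height 1, so
adding a multiple of `l` to a weight is a vertical move. The face opposite `d` is lower if `0 < l d`
and upper if `l d < 0`, and this sign pattern determines the type of flip. Down-flips are up-flips
for `-ω`. -/

/-! ### Barycentric weights as functions on the point set -/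

/-- The total mass that a weight function places on the points of `A`. -/
noncomputable def mass (A : Finset Plane) : (Plane → ℝ) →ₗ[ℝ] ℝ :=
  ∑ p ∈ A, LinearMap.proj p

/-- The weighted sum of the points of `A`. -/
noncomputable def pt (A : Finset Plane) : (Plane → ℝ) →ₗ[ℝ] Plane :=
  ∑ p ∈ A, (LinearMap.proj p : (Plane → ℝ) →ₗ[ℝ] ℝ).smulRight p

/-- The weighted sum of the heights of the points of `A`. -/
noncomputable def ht (A : Finset Plane) (ω : Plane → ℝ) : (Plane → ℝ) →ₗ[ℝ] ℝ :=
  ∑ p ∈ A, ω p • LinearMap.proj p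

theorem mass_apply (A : Finset Plane) (w : Plane → ℝ) : mass A w = ∑ p ∈ A, w p := by
  simp [mass]

theorem pt_apply (A : Finset Plane) (w : Plane → ℝ) : pt A w = ∑ p ∈ A, w p • p := by
  simp [pt]

theorem ht_apply (A : Finset Plane) (ω w : Plane → ℝ) : ht A ω w = ∑ p ∈ A, w p * ω p := by
  simp [ht, mul_comm]

theorem ht_neg (A : Finset Plane) (ω w : Plane → ℝ) : ht A (-ω) w = -ht A ω w := by
  simp [ht_apply]

/-- `w` is a system of barycentric weights supported on `s`. -/
structure IsWeight (A s : Finset Plane) (w : Plane → ℝ) : Prop where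
  nonneg : ∀ p, 0 ≤ w p
  support : ∀ p, p ∉ s → w p = 0
  mass_eq : mass A w = 1

theorem IsWeight.mono {A s t : Finset Plane} {w : Plane → ℝ} (h : IsWeight A s w)
    (hst : s ⊆ t) : IsWeight A t w :=
  ⟨h.nonneg, fun p hp => h.support p fun hs => hp (hst hs), h.mass_eq⟩

theorem IsWeight.of_nonneg_on {A s : Finset Plane} {w : Plane → ℝ} (h : ∀ p ∈ s, 0 ≤ w p)
    (hs : ∀ p, p ∉ s → w p = 0) (hm : mass A w = 1) : IsWeight A s w :=
  ⟨fun p => if hp : p ∈ s then h p hp else (hs p hp).ge, hs, hm⟩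

theorem IsWeight.subset_of_pos {A s t : Finset Plane} {w : Plane → ℝ} (h : IsWeight A t w)
    (hp : ∀ p ∈ s, 0 < w p) : s ⊆ t := fun p hps => by
  by_contra hpt
  exact (hp p hps).ne' (h.support p hpt)

/-- Convex combinations of weights. -/
theorem IsWeight.comb {A s : Finset Plane} {w v : Plane → ℝ} (hw : IsWeight A s w)
    (hv : IsWeight A s v) {a : ℝ} (h0 : 0 ≤ a) (h1 : a ≤ 1) :
    IsWeight A s ((1 - a) • w + a • v) where
  nonneg p := by
    have := hw.nonneg p; have := hv.nonneg p
    have : 0 ≤ 1 - a := by linarith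
    simp only [Pi.add_apply, Pi.smul_apply, smul_eq_mul]
    positivity
  support p hp := by simp [hw.support p hp, hv.support p hp]
  mass_eq := by simp [hw.mass_eq, hv.mass_eq]

/-- The barycentre of a nonempty simplex has positive weights. -/
theorem exists_weight_pos {A s : Finset Plane} (hs : s ⊆ A) (hne : s.Nonempty) :
    ∃ w, IsWeight A s w ∧ ∀ p ∈ s, 0 < w p := by
  classical
  have hc : (0 : ℝ) < s.card := by exact_mod_cast hne.card_pos
  refine ⟨fun p => if p ∈ s then (s.card : ℝ)⁻¹ else 0, ⟨fun p => ?_, fun p hp => by simp [hp], ?_⟩,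
    fun p hp => by simp [hp, hc]⟩
  · split_ifs <;> positivity
  · rw [mass_apply, Finset.sum_ite_mem, Finset.inter_eq_right.2 hs]
    simp [hc.ne']

/-- A small step from positive weights keeps them positive. -/
theorem exists_perturb (s : Finset Plane) (w v : Plane → ℝ) (hw : ∀ p ∈ s, 0 < w p) :
    ∃ e : ℝ, 0 < e ∧ e < 1 ∧ ∀ p ∈ s, 0 < ((1 - e) • w + e • v) p := by
  have h : ∀ᶠ e : ℝ in nhdsWithin 0 (Set.Ioi 0), ∀ p ∈ s, 0 < ((1 - e) • w + e • v) p := by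
    rw [Filter.eventually_all_finset]
    intro p hp
    apply Filter.Eventually.filter_mono nhdsWithin_le_nhds
    have hc : Continuous fun e : ℝ => ((1 - e) • w + e • v) p := by
      simp only [Pi.add_apply, Pi.smul_apply, smul_eq_mul]; fun_prop
    exact hc.continuousAt.eventually_const_lt (by simpa using hw p hp)
  obtain ⟨e, h1, h2, h3⟩ := (h.and ((eventually_mem_nhdsWithin).and
    (Filter.Eventually.filter_mono nhdsWithin_le_nhds (Iio_mem_nhds one_pos)))).exists
  exact ⟨e, h2, h3, h1⟩

/-- Three points in general position admit no affine relation. -/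
theorem InGeneralPosition.eq_zero {A s : Finset Plane} (hA : InGeneralPosition A) (hs : s ⊆ A)
    (hc : s.card ≤ 3) {m : Plane → ℝ} (hm : ∀ p, p ∉ s → m p = 0) (h0 : mass A m = 0)
    (h1 : pt A m = 0) : m = 0 := by
  classical
  rw [mass_apply, ← Finset.sum_subset hs fun p _ hp => hm p hp] at h0
  rw [pt_apply, ← Finset.sum_subset hs fun p _ hp => by rw [hm p hp, zero_smul]] at h1
  suffices h : ∀ p ∈ s, m p = 0 by
    funext p
    by_cases hp : p ∈ s
    exacts [h p hp, hm p hp]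
  obtain h | h | h | h : s.card = 0 ∨ s.card = 1 ∨ s.card = 2 ∨ s.card = 3 := by omega
  · simp [Finset.card_eq_zero.1 h]
  · obtain ⟨a, rfl⟩ := Finset.card_eq_one.1 h
    simpa using h0
  · obtain ⟨a, b, hab, rfl⟩ := Finset.card_eq_two.1 h
    rw [Finset.sum_pair hab] at h0 h1
    have hb : m b = -m a := by linarith
    rw [hb, neg_smul, ← sub_eq_add_neg, ← smul_sub] at h1
    have ha := (smul_eq_zero.1 h1).resolve_right (sub_ne_zero.2 hab)
    simp [ha, hb]
  · obtain ⟨a, b, c, hab, hac, hbc, rfl⟩ := Finset.card_eq_three.1 h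
    have hi := affineIndependent_iff_not_collinear_set.2
      (hA a (hs (by simp)) b (hs (by simp)) c (hs (by simp)) hab hac hbc)
    rw [affineIndependent_iff] at hi
    have h2 := hi Finset.univ ![m a, m b, m c]
    simp only [Fin.sum_univ_three, Finset.mem_univ, true_implies, Fin.forall_fin_succ,
      IsEmpty.forall_iff, and_true] at h2
    rw [Finset.sum_insert (by simp [hab, hac]), Finset.sum_pair hbc] at h0 h1
    simpa using h2 (by simpa [add_assoc] using h0) (by simpa [add_assoc] using h1)

theorem InGeneralPosition.affineIndependent {A s : Finset Plane} (hA : InGeneralPosition A)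
    (hs : s ⊆ A) (hc : s.card ≤ 3) : AffineIndependent ℝ ((↑) : {p // p ∈ s} → Plane) := by
  classical
  rw [affineIndependent_iff_of_fintype]
  intro w hw0 hw1 i
  rw [Finset.weightedVSub_eq_linear_combination _ hw0] at hw1
  have hm : (fun p => if h : p ∈ s then w ⟨p, h⟩ else 0) = 0 := by
    refine hA.eq_zero hs hc (fun p hp => by simp [hp]) ?_ ?_
    · rw [mass_apply, ← Finset.sum_subset hs fun p _ hp => by simp [hp], ← Finset.sum_coe_sort]
      simpa using hw0
    · rw [pt_apply, ← Finset.sum_subset hs fun p _ hp => by simp [hp], ← Finset.sum_coe_sort]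
      simpa using hw1
  simpa using congrFun hm i

/-- A triple in general position is an affine frame of the plane. -/
theorem InGeneralPosition.exists_basis {A f : Finset Plane} (hA : InGeneralPosition A)
    (hf : f ⊆ A) (hc : f.card = 3) :
    ∃ b : AffineBasis {p // p ∈ f} ℝ Plane, ∀ i, b i = i := by
  have hi := hA.affineIndependent hf hc.le
  refine ⟨⟨(↑), hi, ?_⟩, fun i => rfl⟩
  rw [hi.affineSpan_eq_top_iff_card_eq_finrank_add_one]
  simp [hc]

theorem InGeneralPosition.exists_coord {A f : Finset Plane} (hA : InGeneralPosition A)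
    (hf : f ⊆ A) (hc : f.card = 3) (x : Plane) :
    ∃ c : Plane → ℝ, (∀ p, p ∉ f → c p = 0) ∧ mass A c = 1 ∧ pt A c = x := by
  classical
  obtain ⟨b, hb⟩ := hA.exists_basis hf hc
  refine ⟨fun p => if h : p ∈ f then b.coord ⟨p, h⟩ x else 0, fun p hp => by simp [hp], ?_, ?_⟩
  · rw [mass_apply, ← Finset.sum_subset hf fun p _ hp => by simp [hp], ← Finset.sum_coe_sort]
    simpa using b.sum_coord_apply_eq_one x
  · rw [pt_apply, ← Finset.sum_subset hf fun p _ hp => by simp [hp], ← Finset.sum_coe_sort]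
    simpa [hb] using b.linear_combination_coord_eq_self x

/-! ### The circuit of a tetrahedron and vertical motion -/

/-- `l` is the affine dependence of the four points of `t`, normalised so that moving along it
raises the height by one. -/
structure IsCircuit (A : Finset Plane) (ω : Plane → ℝ) (t : Finset Plane) (l : Plane → ℝ) :
    Prop where
  support : ∀ p, p ∉ t → l p = 0
  ne_zero : ∀ p ∈ t, l p ≠ 0
  mass_eq : mass A l = 0
  pt_eq : pt A l = 0
  ht_eq : ht A ω l = 1

theorem IsCircuit.neg {A : Finset Plane} {ω : Plane → ℝ} {t : Finset Plane} {l : Plane → ℝ}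
    (h : IsCircuit A ω t l) : IsCircuit A (-ω) t (-l) where
  support p hp := by simp [h.support p hp]
  ne_zero p hp := by simpa using h.ne_zero p hp
  mass_eq := by simp [h.mass_eq]
  pt_eq := by simp [h.pt_eq]
  ht_eq := by simp [ht_neg, h.ht_eq]

/-- The weights on faces of `K` are determined by the points of the lifted simplices. -/
def LiftInj (A : Finset Plane) (ω : Plane → ℝ) (K : Set (Finset Plane)) : Prop :=
  ∀ s ∈ K, ∀ s' ∈ K, ∀ w w', IsWeight A s w → IsWeight A s' w' → pt A w = pt A w' →
    ht A ω w = ht A ω w' → w = w'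

theorem LiftInj.neg {A : Finset Plane} {ω : Plane → ℝ} {K : Set (Finset Plane)}
    (h : LiftInj A ω K) : LiftInj A (-ω) K := fun s hs s' hs' w w' hw hw' h1 h2 =>
  h s hs s' hs' w w' hw hw' h1 (by simpa [ht_neg] using h2)

/-- Four points of the plane are affinely dependent. General position makes every coefficient
nonzero, and nondegeneracy of the lift makes the height of the dependence nonzero, so it can be
normalised. -/
theorem exists_isCircuit {A : Finset Plane} {ω : Plane → ℝ} {K : Set (Finset Plane)}
    {t : Finset Plane} (hA : InGeneralPosition A) (hK : LiftInj A ω K) (htK : t ∈ K) (htA : t ⊆ A)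
    (hc : t.card = 4) : ∃ l, IsCircuit A ω t l := by
  classical
  obtain ⟨f, hf1, hf0, q, hq, hfq⟩ := Module.exists_nontrivial_relation_sum_zero_of_finrank_succ_lt_card
    (R := ℝ) (t := t) (by simp [hc])
  set l : Plane → ℝ := fun p => if p ∈ t then f p else 0 with hl
  have hsupp : ∀ p, p ∉ t → l p = 0 := fun p hp => by simp [hl, hp]
  have hm : mass A l = 0 := by
    rw [mass_apply, ← Finset.sum_subset htA fun p _ hp => hsupp p hp, ← hf0]
    exact Finset.sum_congr rfl fun p hp => by simp [hl, hp]
  have hp : pt A l = 0 := by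
    rw [pt_apply, ← Finset.sum_subset htA fun p _ hp => by rw [hsupp p hp, zero_smul], ← hf1]
    exact Finset.sum_congr rfl fun p hp => by simp [hl, hp]
  have hne : l ≠ 0 := fun h => hfq (by simpa [hl, hq] using congrFun h q)
  have hz : ∀ p ∈ t, l p ≠ 0 := fun p hpt h0 => hne <| by
    refine hA.eq_zero (s := t.erase p) ((Finset.erase_subset _ _).trans htA)
      (by rw [Finset.card_erase_of_mem hpt]; omega) (fun r hr => ?_) hm hp
    by_cases hrp : r = p
    · rw [hrp, h0]
    · exact hsupp r fun h => hr (Finset.mem_erase.2 ⟨hrp, h⟩)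
  -- If the height vanished, the barycentre and a small shift of it along `l` would be different
  -- weights with the same lifted point.
  have hh : ht A ω l ≠ 0 := fun h0 => by
    obtain ⟨w, hw, hpos⟩ := exists_weight_pos htA (Finset.card_pos.1 (by omega))
    obtain ⟨e, he, -, hep⟩ := exists_perturb t w (w + l) hpos
    have hw' : IsWeight A t ((1 - e) • w + e • (w + l)) :=
      IsWeight.of_nonneg_on (fun p h => (hep p h).le)
        (fun p h => by simp [hw.support p h, hsupp p h]) (by simp [hw.mass_eq, hm])
    have := hK t htK t htK _ _ hw' hw (by simp [hp, ← add_smul]) (by simp [h0]; ring)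
    rw [smul_add, ← add_assoc, ← add_smul, sub_add_cancel, one_smul, add_eq_left] at this
    exact hne ((smul_eq_zero.1 this).resolve_left he.ne')
  refine ⟨(ht A ω l)⁻¹ • l, fun p h => by simp [hsupp p h], fun p h => ?_, by simp [hm],
    by simp [hp], by simp [hh]⟩
  simpa [hh] using hz p h

section Circuit

variable {A : Finset Plane} {ω : Plane → ℝ} {t : Finset Plane} {l : Plane → ℝ}

/-- Two systems of coordinates over the same point differ by a multiple of the circuit. -/
theorem IsCircuit.eq_add_smul (hA : InGeneralPosition A) (htA : t ⊆ A) (hc : t.card = 4)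
    (hl : IsCircuit A ω t l) {w w' : Plane → ℝ} (hw : ∀ p, p ∉ t → w p = 0)
    (hw' : ∀ p, p ∉ t → w' p = 0) (hm : mass A w = mass A w') (hp : pt A w = pt A w') :
    w' = w + (ht A ω w' - ht A ω w) • l := by
  classical
  obtain ⟨d, hd⟩ : t.Nonempty := Finset.card_pos.1 (by omega)
  set a := (w' d - w d) / l d with ha
  have hld := hl.ne_zero d hd
  -- The factor `a` cancels the coefficient at `d`, which leaves a dependence among three points.
  have key : w' - w - a • l = 0 := by
    refine hA.eq_zero (s := t.erase d) ((Finset.erase_subset _ _).trans htA)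
      (by rw [Finset.card_erase_of_mem hd]; omega) (fun p hpe => ?_) ?_ ?_
    · by_cases hpd : p = d
      · subst hpd; simp only [Pi.sub_apply, Pi.smul_apply, smul_eq_mul, ha]; field_simp; ring
      · have : p ∉ t := fun h => hpe (Finset.mem_erase.2 ⟨hpd, h⟩)
        simp [hw p this, hw' p this, hl.support p this]
    · simp [hm, hl.mass_eq]
    · simp [hp, hl.pt_eq]
  have h2 := congrArg (ht A ω) key
  simp only [map_sub, map_smul, hl.ht_eq, smul_eq_mul, mul_one, map_zero] at h2
  have : w' = w + a • l := by rw [← sub_eq_zero, ← key]; abel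
  rw [show ht A ω w' - ht A ω w = a by linarith]; exact this

theorem IsCircuit.isWeight_add (hl : IsCircuit A ω t l) {w : Plane → ℝ} (hw : IsWeight A t w)
    {a : ℝ} (h : ∀ p ∈ t, 0 ≤ w p + a * l p) : IsWeight A t (w + a • l) :=
  IsWeight.of_nonneg_on h (fun p hp => by simp [hw.support p hp, hl.support p hp])
    (by simp [hw.mass_eq, hl.mass_eq])

theorem IsCircuit.pt_add (hl : IsCircuit A ω t l) (w : Plane → ℝ) (a : ℝ) :
    pt A (w + a • l) = pt A w := by simp [hl.pt_eq]

theorem IsCircuit.ht_add (hl : IsCircuit A ω t l) (w : Plane → ℝ) (a : ℝ) :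
    ht A ω (w + a • l) = ht A ω w + a := by simp [hl.ht_eq]

theorem IsCircuit.exists_neg (hl : IsCircuit A ω t l) (htA : t ⊆ A) (hc : t.card = 4) :
    ∃ d ∈ t, l d < 0 := by
  classical
  by_contra! h
  have h1 := hl.mass_eq
  rw [mass_apply, ← Finset.sum_subset htA fun p _ hp => hl.support p hp] at h1
  obtain ⟨d, hd⟩ : t.Nonempty := Finset.card_pos.1 (by omega)
  exact hl.ne_zero d hd ((Finset.sum_eq_zero_iff_of_nonneg h).1 h1 d hd)

theorem IsCircuit.exists_pos (hl : IsCircuit A ω t l) (htA : t ⊆ A) (hc : t.card = 4) :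
    ∃ d ∈ t, 0 < l d := by
  simpa using hl.neg.exists_neg htA hc

/-- Every point of a tetrahedron lies vertically below a point of an upper face. -/
theorem IsCircuit.exists_top (hl : IsCircuit A ω t l) (htA : t ⊆ A) (hc : t.card = 4)
    {w : Plane → ℝ} (hw : IsWeight A t w) :
    ∃ a : ℝ, 0 ≤ a ∧ ∃ d ∈ t, l d < 0 ∧ IsWeight A (t.erase d) (w + a • l) := by
  classical
  obtain ⟨d0, hd0, hn0⟩ := hl.exists_neg htA hc
  -- Ratio test: moving up, only coordinates with `l p < 0` decrease, and the minimiser is a first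
  -- one to reach zero.
  obtain ⟨d, hd, hmin⟩ := (t.filter fun p => l p < 0).exists_min_image (fun p => w p / (-l p))
    ⟨d0, by simp [hd0, hn0]⟩
  rw [Finset.mem_filter] at hd
  obtain ⟨hd, hn⟩ := hd
  have hn' : 0 < -l d := by linarith
  have ha : 0 ≤ w d / (-l d) := div_nonneg (hw.nonneg d) hn'.le
  refine ⟨w d / (-l d), ha, d, hd, hn, ?_⟩
  have hW : IsWeight A t (w + (w d / (-l d)) • l) := by
    refine hl.isWeight_add hw fun p hp => ?_
    rcases lt_or_ge (l p) 0 with h | h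
    · have h1 := hmin p (by simp [hp, h])
      have h2 : 0 < -l p := by linarith
      have h3 := (le_div_iff₀ h2).1 h1
      linarith
    · have := hw.nonneg p
      positivity
  refine ⟨hW.nonneg, fun p hp => ?_, hW.mass_eq⟩
  by_cases hpd : p = d
  · subst hpd
    simp only [Pi.add_apply, Pi.smul_apply, smul_eq_mul]
    have := hn.ne
    field_simp; ring
  · exact hW.support p fun h => hp (Finset.mem_erase.2 ⟨hpd, h⟩)

/-- Every point of a tetrahedron lies vertically above a point of a lower face. -/
theorem IsCircuit.exists_bottom (hl : IsCircuit A ω t l) (htA : t ⊆ A) (hc : t.card = 4)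
    {w : Plane → ℝ} (hw : IsWeight A t w) :
    ∃ a : ℝ, a ≤ 0 ∧ ∃ d ∈ t, 0 < l d ∧ IsWeight A (t.erase d) (w + a • l) := by
  obtain ⟨a, ha, d, hd, hn, h⟩ := hl.neg.exists_top htA hc hw
  exact ⟨-a, by linarith, d, hd, by simpa using hn, by simpa using h⟩

/-- Points of upper faces are the highest points of the tetrahedron. -/
theorem IsCircuit.ht_le_of_upper (hA : InGeneralPosition A) (htA : t ⊆ A) (hc : t.card = 4)
    (hl : IsCircuit A ω t l) {d : Plane} (hd : l d < 0) {w w' : Plane → ℝ}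
    (hw : IsWeight A (t.erase d) w) (hw' : IsWeight A t w') (hp : pt A w = pt A w') :
    ht A ω w' ≤ ht A ω w := by
  classical
  have hwt := hw.mono (Finset.erase_subset d t)
  have h := hl.eq_add_smul hA htA hc hwt.support hw'.support
    (hwt.mass_eq.trans hw'.mass_eq.symm) hp
  have h1 := congrFun h d
  have h2 := hw'.nonneg d
  rw [h1] at h2
  simp only [Pi.add_apply, Pi.smul_apply, smul_eq_mul, hw.support d (by simp), zero_add] at h2
  nlinarith

theorem IsCircuit.le_ht_of_lower (hA : InGeneralPosition A) (htA : t ⊆ A) (hc : t.card = 4)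
    (hl : IsCircuit A ω t l) {d : Plane} (hd : 0 < l d) {w w' : Plane → ℝ}
    (hw : IsWeight A (t.erase d) w) (hw' : IsWeight A t w') (hp : pt A w = pt A w') :
    ht A ω w ≤ ht A ω w' := by
  have := hl.neg.ht_le_of_upper hA htA hc (d := d) (by simpa using hd) hw hw' hp
  simpa [ht_neg] using this

/-- The midpoint of a nondegenerate vertical segment is interior to the tetrahedron. -/
theorem IsCircuit.midpoint_pos (hA : InGeneralPosition A) (htA : t ⊆ A) (hc : t.card = 4)
    (hl : IsCircuit A ω t l) {w w' : Plane → ℝ} (hw : IsWeight A t w) (hw' : IsWeight A t w')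
    (hp : pt A w = pt A w') (hne : w ≠ w') :
    ∃ m, IsWeight A t m ∧ (∀ p ∈ t, 0 < m p) ∧ pt A m = pt A w ∧
      ht A ω m = (ht A ω w + ht A ω w') / 2 := by
  have h := hl.eq_add_smul hA htA hc hw.support hw'.support (hw.mass_eq.trans hw'.mass_eq.symm) hp
  have hm := hw.comb hw' (a := 1 / 2) (by norm_num) (by norm_num)
  refine ⟨_, hm, fun p hpt => (hm.nonneg p).lt_of_ne fun h0 => hne ?_, ?_, ?_⟩
  -- A vanishing coordinate of the midpoint vanishes at both ends. As `l p ≠ 0`, the vertical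
  -- displacement is then zero.
  · have h1 := hw.nonneg p
    have h2 := hw'.nonneg p
    simp only [Pi.add_apply, Pi.smul_apply, smul_eq_mul] at h0
    have h3 := congrFun h p
    simp only [Pi.add_apply, Pi.smul_apply, smul_eq_mul] at h3
    have h4 : (ht A ω w' - ht A ω w) * l p = 0 := by linarith
    have h5 := (mul_eq_zero.1 h4).resolve_right (hl.ne_zero p hpt)
    rw [h, h5]; simp
  · simp only [map_add, map_smul, ← hp, ← add_smul]; norm_num
  · simp only [map_add, map_smul, smul_eq_mul]; ring

/-- A tetrahedron is an affine frame of space. -/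
theorem IsCircuit.exists_coord (hA : InGeneralPosition A) (htA : t ⊆ A) (hc : t.card = 4)
    (hl : IsCircuit A ω t l) (x : Plane) (z : ℝ) :
    ∃ c : Plane → ℝ, (∀ p, p ∉ t → c p = 0) ∧ mass A c = 1 ∧ pt A c = x ∧ ht A ω c = z := by
  classical
  obtain ⟨d, hd⟩ : t.Nonempty := Finset.card_pos.1 (by omega)
  obtain ⟨c, h0, h1, h2⟩ := hA.exists_coord (f := t.erase d)
    ((Finset.erase_subset _ _).trans htA) (by rw [Finset.card_erase_of_mem hd, hc]) x
  refine ⟨c + (z - ht A ω c) • l, fun p hp => ?_, ?_, ?_, ?_⟩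
  · simp [h0 p fun h => hp (Finset.mem_of_mem_erase h), hl.support p hp]
  · simp [h1, hl.mass_eq]
  · simp [h2, hl.pt_eq]
  · simp [hl.ht_eq]

end Circuit

/-! ### Triangulations and fillings in terms of weights -/

/-- The faces of a triangulation of `A`, described through barycentric weights. -/
structure Tri (A : Finset Plane) (T : Set (Finset Plane)) : Prop where
  subset : ∀ s ∈ T, s ⊆ A
  nonempty : ∀ s ∈ T, s.Nonempty
  down : ∀ s ∈ T, ∀ s' ⊆ s, s'.Nonempty → s' ∈ T
  inj : ∀ s ∈ T, ∀ s' ∈ T, ∀ w w', IsWeight A s w → IsWeight A s' w' → pt A w = pt A w' → w = w'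
  cover : ∀ w, IsWeight A A w → ∃ s ∈ T, ∃ u, IsWeight A s u ∧ pt A u = pt A w

/-- `K` consists of the projected faces of a Steiner-free filling of the polyhedron between the
lifts of `Tu` and `Tv`. -/
structure Filling (A : Finset Plane) (ω : Plane → ℝ) (K Tu Tv : Set (Finset Plane)) : Prop where
  gen : InGeneralPosition A
  triU : Tri A Tu
  triV : Tri A Tv
  subset : ∀ s ∈ K, s ⊆ A
  down : ∀ s ∈ K, ∀ s' ⊆ s, s'.Nonempty → s' ∈ K
  card_le : ∀ s ∈ K, s.card ≤ 4
  inj : LiftInj A ω K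
  lower_mem : Tu ⊆ K
  upper_mem : Tv ⊆ K
  lower_le : ∀ s ∈ K, ∀ w, IsWeight A s w → ∀ s' ∈ Tu, ∀ u, IsWeight A s' u → pt A u = pt A w →
    ht A ω u ≤ ht A ω w
  le_upper : ∀ s ∈ K, ∀ w, IsWeight A s w → ∀ s' ∈ Tv, ∀ u, IsWeight A s' u → pt A u = pt A w →
    ht A ω w ≤ ht A ω u
  fill : ∀ s ∈ Tu, ∀ u, IsWeight A s u → ∀ s' ∈ Tv, ∀ v, IsWeight A s' v → pt A u = pt A v →
    ∀ z, ht A ω u ≤ z → z ≤ ht A ω v → ∃ r ∈ K, ∃ w, IsWeight A r w ∧ pt A w = pt A u ∧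
      ht A ω w = z

/-- Turning space upside down exchanges the two boundary triangulations. This reduces down-flips to
up-flips. -/
theorem Filling.neg {A : Finset Plane} {ω : Plane → ℝ} {K Tu Tv : Set (Finset Plane)}
    (h : Filling A ω K Tu Tv) : Filling A (-ω) K Tv Tu where
  gen := h.gen
  triU := h.triV
  triV := h.triU
  subset := h.subset
  down := h.down
  card_le := h.card_le
  inj := h.inj.neg
  lower_mem := h.upper_mem
  upper_mem := h.lower_mem
  lower_le s hs w hw s' hs' u hu hp := by
    simpa [ht_neg] using h.le_upper s hs w hw s' hs' u hu hp
  le_upper s hs w hw s' hs' u hu hp := by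
    simpa [ht_neg] using h.lower_le s hs w hw s' hs' u hu hp
  fill s hs u hu s' hs' v hv hp z h1 h2 := by
    obtain ⟨r, hr, w, hw, hwp, hwz⟩ := h.fill s' hs' v hv s hs u hu hp.symm (-z)
      (by rw [ht_neg] at h2; linarith) (by rw [ht_neg] at h1; linarith)
    exact ⟨r, hr, w, hw, hwp.trans hp.symm, by rw [ht_neg, hwz, neg_neg]⟩

/-- The projected tetrahedra among the faces `K`. -/
def tets (K : Set (Finset Plane)) : Set (Finset Plane) := {t | t ∈ K ∧ t.card = 4}

/-- Seen from below, `s` is in front of `t`, both being tetrahedra of `K`. -/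
def Before (A : Finset Plane) (ω : Plane → ℝ) (K : Set (Finset Plane)) (s t : Finset Plane) :
    Prop :=
  s ∈ tets K ∧ t ∈ tets K ∧ s ≠ t ∧ ∃ w w', IsWeight A s w ∧ IsWeight A t w' ∧
    pt A w = pt A w' ∧ ht A ω w < ht A ω w'

/-! ### The sweeping front -/

/-- The triangulation `T` is a section of the filling, and `Q` is the set of tetrahedra above. -/
structure Front (A : Finset Plane) (ω : Plane → ℝ) (K Tv T Q : Set (Finset Plane)) : Prop where
  tri : Tri A T
  sub : T ⊆ K
  queue_sub : Q ⊆ tets K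
  above : ∀ t ∈ Q, ∀ w, IsWeight A t w → ∀ s ∈ T, ∀ u, IsWeight A s u → pt A u = pt A w →
    ht A ω u ≤ ht A ω w
  cover : ∀ s ∈ T, ∀ u, IsWeight A s u → ∀ s' ∈ Tv, ∀ v, IsWeight A s' v → pt A u = pt A v →
    ∀ z, ht A ω u < z → z < ht A ω v →
    (∀ r ∈ K, r.card ≤ 3 → ∀ w, IsWeight A r w → pt A w = pt A u → ht A ω w ≠ z) →
    ∃ t ∈ Q, ∃ w, IsWeight A t w ∧ pt A w = pt A u ∧ ht A ω w = z

section

variable {A : Finset Plane} {ω : Plane → ℝ} {K Tu Tv T Q : Set (Finset Plane)}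

/-- At a height that avoids all faces with at most three vertices, the face containing the point
must be a tetrahedron, since no face has more than four vertices. -/
theorem Filling.front (h : Filling A ω K Tu Tv) : Front A ω K Tv Tu (tets K) where
  tri := h.triU
  sub := h.lower_mem
  queue_sub := subset_rfl
  above t ht w hw s hs u hu hp := h.lower_le t ht.1 w hw s hs u hu hp
  cover s hs u hu s' hs' v hv hp z h1 h2 hz := by
    obtain ⟨r, hr, w, hw, hwp, hwz⟩ := h.fill s hs u hu s' hs' v hv hp z h1.le h2.le
    refine ⟨r, ⟨hr, ?_⟩, w, hw, hwp, hwz⟩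
    by_contra hc
    have := h.card_le r hr
    exact hz r hr (by omega) w hw hwp hwz

/-- Faces with at most three vertices meet a vertical line in finitely many points. -/
theorem Filling.exists_height (h : Filling A ω K Tu Tv) (x : Plane) {a b : ℝ} (hab : a < b) :
    ∃ z, a < z ∧ z < b ∧
      ∀ r ∈ K, r.card ≤ 3 → ∀ w, IsWeight A r w → pt A w = x → ht A ω w ≠ z := by
  classical
  have hK : K.Finite := (A.powerset : Set (Finset Plane)).toFinite.subset fun s hs => by
    simpa using h.subset s hs
  have hfin : (⋃ r ∈ K, {z | r.card ≤ 3 ∧ ∃ w, IsWeight A r w ∧ pt A w = x ∧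
      ht A ω w = z}).Finite := by
    refine hK.biUnion fun r hr => Set.Subsingleton.finite ?_
    rintro z ⟨hc, w, hw, hwp, rfl⟩ z' ⟨-, w', hw', hwp', rfl⟩
    have : w - w' = 0 := h.gen.eq_zero (h.subset r hr) hc
      (fun p hp => by simp [hw.support p hp, hw'.support p hp])
      (by simp [hw.mass_eq, hw'.mass_eq]) (by simp [hwp, hwp'])
    rw [sub_eq_zero.1 this]
  obtain ⟨z, hz, hz'⟩ := (Set.Ioo_infinite hab).exists_notMem_finite hfin
  refine ⟨z, hz.1, hz.2, fun r hr hc w hw hp hh => hz' ?_⟩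
  simp only [Set.mem_iUnion]
  exact ⟨r, hr, hc, w, hw, hp, hh⟩

theorem Filling.exists_isCircuit (h : Filling A ω K Tu Tv) {t : Finset Plane} (ht : t ∈ tets K) :
    ∃ l, IsCircuit A ω t l :=
  _root_.exists_isCircuit h.gen h.inj ht.1 (h.subset t ht.1) ht.2

theorem Front.subset_of_mem (hF : Front A ω K Tv T Q) (h : Filling A ω K Tu Tv)
    {t : Finset Plane} (ht : t ∈ Q) : t ⊆ A := h.subset t (hF.queue_sub ht).1

theorem IsWeight.full {s : Finset Plane} {w : Plane → ℝ} (hw : IsWeight A s w) (hs : s ⊆ A) :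
    IsWeight A A w := hw.mono hs

/-- When no tetrahedra are left, the front has reached the top. -/
theorem Front.eq_of_queue_empty (h : Filling A ω K Tu Tv) (hF : Front A ω K Tv T Q)
    (hQ : Q = ∅) : T = Tv := by
  -- A vertical gap between the sections would contain a generic height, which the invariant places
  -- in a tetrahedron of the empty queue. So the heights agree, and injectivity of the lift
  -- identifies the weights.
  have key : ∀ s ∈ T, ∀ u, IsWeight A s u → ∀ s' ∈ Tv, ∀ v, IsWeight A s' v → pt A u = pt A v →
      u = v := by
    intro s hs u hu s' hs' v hv hp
    refine h.inj s (hF.sub hs) s' (h.upper_mem hs') u v hu hv hp (le_antisymm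
      (h.le_upper s (hF.sub hs) u hu s' hs' v hv hp.symm) (not_lt.1 fun hlt => ?_))
    obtain ⟨z, h1, h2, h3⟩ := h.exists_height (pt A u) hlt
    obtain ⟨t, ht, -⟩ := hF.cover s hs u hu s' hs' v hv hp z h1 h2 h3
    simp [hQ] at ht
  ext s
  constructor
  · intro hs
    -- A weight positive on all of `s` that is also supported on a face of the other triangulation
    -- puts `s` inside that face.
    obtain ⟨w, hw, hpos⟩ := exists_weight_pos (hF.tri.subset s hs) (hF.tri.nonempty s hs)
    obtain ⟨s', hs', v, hv, hp⟩ := h.triV.cover w (hw.full (hF.tri.subset s hs))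
    rw [← key s hs w hw s' hs' v hv hp.symm] at hv
    exact h.triV.down s' hs' s (hv.subset_of_pos hpos) (hF.tri.nonempty s hs)
  · intro hs
    obtain ⟨w, hw, hpos⟩ := exists_weight_pos (h.triV.subset s hs) (h.triV.nonempty s hs)
    obtain ⟨s', hs', v, hv, hp⟩ := hF.tri.cover w (hw.full (h.triV.subset s hs))
    rw [key s' hs' v hv s hs w hw hp] at hv
    exact hF.tri.down s' hs' s (hv.subset_of_pos hpos) (h.triV.nonempty s hs)

/-- A weight that is positive on a face of the tetrahedron can be moved slightly inwards. -/
theorem IsCircuit.exists_inward {t : Finset Plane} {l : Plane → ℝ} (hl : IsCircuit A ω t l)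
    (htA : t ⊆ A) (hc : t.card = 4) {d : Plane} (hd : d ∈ t) (hld : 0 < l d) :
    ∃ w, IsWeight A (t.erase d) w ∧ (∀ p ∈ t.erase d, 0 < w p) ∧
      ∃ e : ℝ, 0 < e ∧ IsWeight A t (w + e • l) ∧ ∀ p ∈ t, 0 < (w + e • l) p := by
  classical
  obtain ⟨w, hw, hpos⟩ := exists_weight_pos (A := A) (s := t.erase d)
    ((Finset.erase_subset _ _).trans htA)
    (Finset.card_pos.1 (by rw [Finset.card_erase_of_mem hd]; omega))
  obtain ⟨e, he, -, hep⟩ := exists_perturb (t.erase d) w (w + l) hpos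
  have heq : (1 - e) • w + e • (w + l) = w + e • l := by
    rw [smul_add, ← add_assoc, ← add_smul, sub_add_cancel, one_smul]
  rw [heq] at hep
  have hp : ∀ p ∈ t, 0 < (w + e • l) p := fun p hp => by
    by_cases hpd : p = d
    · subst hpd
      simp only [Pi.add_apply, Pi.smul_apply, smul_eq_mul, hw.support p (by simp), zero_add]
      positivity
    · exact hep p (Finset.mem_erase.2 ⟨hpd, hp⟩)
  exact ⟨w, hw, hpos, e, he,
    hl.isWeight_add (hw.mono (Finset.erase_subset _ _)) fun p h => (hp p h).le, hp⟩

/-- Exposed faces of remaining tetrahedra are lower faces. -/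
theorem Front.pos_of_exposed (h : Filling A ω K Tu Tv) (hF : Front A ω K Tv T Q)
    {t : Finset Plane} {l : Plane → ℝ} (ht : t ∈ Q) (hl : IsCircuit A ω t l) {d : Plane}
    (hd : d ∈ t) (hT : t.erase d ∈ T) : 0 < l d := by
  classical
  by_contra hn
  have hn : 0 < (-l) d := by
    have := (not_lt.1 hn).lt_of_ne (hl.ne_zero d hd)
    simpa using this
  obtain ⟨w, hw, -, e, he, hwe, -⟩ := hl.neg.exists_inward (hF.subset_of_mem h ht)
    (hF.queue_sub ht).2 hd hn
  have := hF.above t ht _ hwe _ hT w hw (hl.neg.pt_add w e).symm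
  have h2 := hl.neg.ht_add w e
  rw [ht_neg, ht_neg] at h2
  linarith

/-- All lower faces of a tetrahedron with nothing in front of it are exposed. -/
theorem Front.exposed_of_pos (h : Filling A ω K Tu Tv) (hF : Front A ω K Tv T Q)
    {t : Finset Plane} {l : Plane → ℝ} (htQ : t ∈ Q) (hl : IsCircuit A ω t l)
    (hmin : ∀ s ∈ Q, ¬ Before A ω K s t) {d : Plane}
    (hd : d ∈ t) (hld : 0 < l d) : t.erase d ∈ T := by
  classical
  have htA := hF.subset_of_mem h htQ
  obtain ⟨htK, hc⟩ := hF.queue_sub htQ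
  have hne : (t.erase d).Nonempty :=
    Finset.card_pos.1 (by rw [Finset.card_erase_of_mem hd]; omega)
  obtain ⟨w, hw, hpos⟩ := exists_weight_pos ((Finset.erase_subset d t).trans htA) hne
  have hwt := hw.mono (Finset.erase_subset d t)
  obtain ⟨s, hs, u, hu, hup⟩ := hF.tri.cover w (hwt.full htA)
  obtain ⟨s', hs', v, hv, hvp⟩ := h.triV.cover w (hwt.full htA)
  -- A gap between the section and this lower face would contain a point of some queued `t'`. It
  -- lies strictly below the lower face, so `t' ≠ t`, and `t'` is in front of `t`.
  have heq : ht A ω u = ht A ω w := by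
    refine le_antisymm (hF.above t htQ w hwt s hs u hu hup) (not_lt.1 fun hlt => ?_)
    have hle := h.le_upper t htK w hwt s' hs' v hv hvp
    obtain ⟨z, h1, h2, h3⟩ := h.exists_height (pt A u) hlt
    obtain ⟨t', ht', w', hw', hwp', hwz⟩ := hF.cover s hs u hu s' hs' v hv (hup.trans hvp.symm) z
      h1 (h2.trans_le hle) h3
    refine hmin t' ht' ⟨hF.queue_sub ht', hF.queue_sub htQ, ?_, w', w, hw', hwt,
      hwp'.trans hup, by rw [hwz]; exact h2⟩
    rintro rfl
    have := hl.le_ht_of_lower h.gen htA hc hld hw hw' (hup.symm.trans hwp'.symm)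
    linarith
  have := h.inj s (hF.sub hs) t htK u w hu hwt hup heq
  rw [this] at hu
  exact hF.tri.down s hs _ (hu.subset_of_pos hpos) hne

/-! ### A flip preserves the invariant -/

/-- The simplex `s` meets the interior of the projected tetrahedron `t`. -/
def MeetsInterior (A s t : Finset Plane) : Prop :=
  ∃ w w', IsWeight A s w ∧ IsWeight A t w' ∧ (∀ p ∈ t, 0 < w' p) ∧ pt A w = pt A w'

/-- The faces of the triangulation obtained from `T` by flipping the tetrahedron `t`. -/
def flipFaces (A t : Finset Plane) (l : Plane → ℝ) (T : Set (Finset Plane)) :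
    Set (Finset Plane) :=
  {s | (s ∈ T ∧ ¬ MeetsInterior A s t) ∨ (s.Nonempty ∧ ∃ d ∈ t, l d < 0 ∧ s ⊆ t.erase d)}

section Flip

variable {t : Finset Plane} {l : Plane → ℝ}

/-- Moving the common point slightly towards the barycentre of `s` keeps it interior to `t` and
makes its weight positive on `s`. Dropped to a lower face of `t`, which belongs to `T`, the point
must have the same weight there. -/
theorem Tri.subset_lower_of_meetsInterior (hA : InGeneralPosition A) (htA : t ⊆ A)
    (hc : t.card = 4) (hl : IsCircuit A ω t l) (hT : Tri A T)
    (hlow : ∀ d ∈ t, 0 < l d → t.erase d ∈ T) {s : Finset Plane} (hs : s ∈ T)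
    (hm : MeetsInterior A s t) : ∃ d ∈ t, 0 < l d ∧ s ⊆ t.erase d := by
  classical
  obtain ⟨w, w', hw, hw', hpos, hp⟩ := hm
  obtain ⟨c, hcw, hcpos⟩ := exists_weight_pos (hT.subset s hs) (hT.nonempty s hs)
  -- These are signed coordinates with respect to `t`. The height 0 is arbitrary, because only the
  -- planar projection is used.
  obtain ⟨c', h0, h1, h2, -⟩ := hl.exists_coord hA htA hc (pt A c) 0
  obtain ⟨e, he, he1, hep⟩ := exists_perturb t w' c' hpos
  have hW : IsWeight A t ((1 - e) • w' + e • c') :=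
    IsWeight.of_nonneg_on (fun p h => (hep p h).le) (fun p h => by simp [hw'.support p h, h0 p h])
      (by simp [hw'.mass_eq, h1])
  have hV := hw.comb hcw he.le he1.le
  obtain ⟨a, -, d, hd, hld, hB⟩ := hl.exists_bottom htA hc hW
  refine ⟨d, hd, hld, ?_⟩
  have := hT.inj _ (hlow d hd hld) s hs _ _ hB hV (by rw [hl.pt_add]; simp [hp, h2])
  rw [this] at hB
  refine hB.subset_of_pos fun p hps => ?_
  have := hw.nonneg p
  have := hcpos p hps
  have : 0 < 1 - e := by linarith
  simp only [Pi.add_apply, Pi.smul_apply, smul_eq_mul]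
  positivity

/-- Below `w` lies a point of a lower face, and by injectivity in `T` its weight is `u`. If `u ≠ w`,
the midpoint of the vertical segment would be interior to `t` and lie over `s`. -/
theorem Tri.unique_of_not_meetsInterior (hA : InGeneralPosition A) (htA : t ⊆ A)
    (hc : t.card = 4) (hl : IsCircuit A ω t l) (hT : Tri A T)
    (hlow : ∀ d ∈ t, 0 < l d → t.erase d ∈ T) {s : Finset Plane} (hs : s ∈ T)
    (hm : ¬ MeetsInterior A s t) {u w : Plane → ℝ} (hu : IsWeight A s u) (hw : IsWeight A t w)
    (hp : pt A u = pt A w) : u = w := by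
  obtain ⟨a, -, d, hd, hld, hB⟩ := hl.exists_bottom htA hc hw
  have hub := hT.inj s hs _ (hlow d hd hld) _ _ hu hB (by rw [hl.pt_add, hp])
  have hut : IsWeight A t u := hub ▸ hB.mono (Finset.erase_subset _ _)
  by_contra hne
  obtain ⟨m, hm1, hm2, hm3, -⟩ := hl.midpoint_pos hA htA hc hut hw hp hne
  exact hm ⟨u, m, hu, hm1, hm2, hm3.symm⟩

/-- Points over the removed simplices are recovered by pushing them up to the top of `t`. Two upper
faces over the same point have the same height there, hence the same weight, and a retained simplex
overlaps `t` only in common weights. -/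
theorem Tri.flip (hA : InGeneralPosition A) (htA : t ⊆ A) (hc : t.card = 4)
    (hl : IsCircuit A ω t l) (hT : Tri A T) (hlow : ∀ d ∈ t, 0 < l d → t.erase d ∈ T) :
    Tri A (flipFaces A t l T) where
  subset := by
    rintro s (⟨hs, -⟩ | ⟨-, d, -, -, hs⟩)
    exacts [hT.subset s hs, hs.trans ((Finset.erase_subset _ _).trans htA)]
  nonempty := by
    rintro s (⟨hs, -⟩ | ⟨hs, -⟩)
    exacts [hT.nonempty s hs, hs]
  down := by
    rintro s (⟨hs, hm⟩ | ⟨-, d, hd, hld, hs⟩) s' hss hne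
    · exact Or.inl ⟨hT.down s hs s' hss hne, fun ⟨w, w', hw, h⟩ => hm ⟨w, w', hw.mono hss, h⟩⟩
    · exact Or.inr ⟨hne, d, hd, hld, hss.trans hs⟩
  inj := by
    rintro s (⟨hs, hm⟩ | ⟨-, d, hd, hld, hs⟩) s' (⟨hs', hm'⟩ | ⟨-, d', hd', hld', hs'⟩) w w' hw hw' hp
    · exact hT.inj s hs s' hs' w w' hw hw' hp
    · exact hT.unique_of_not_meetsInterior hA htA hc hl hlow hs hm hw
        (hw'.mono (hs'.trans (Finset.erase_subset _ _))) hp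
    · exact (hT.unique_of_not_meetsInterior hA htA hc hl hlow hs' hm' hw'
        (hw.mono (hs.trans (Finset.erase_subset _ _))) hp.symm).symm
    · have hwt := hw.mono (hs.trans (Finset.erase_subset _ _))
      have hwt' := hw'.mono (hs'.trans (Finset.erase_subset _ _))
      have h1 := hl.ht_le_of_upper hA htA hc hld (hw.mono hs) hwt' hp
      have h2 := hl.ht_le_of_upper hA htA hc hld' (hw'.mono hs') hwt hp.symm
      rw [hl.eq_add_smul hA htA hc hwt.support hwt'.support
        (hwt.mass_eq.trans hwt'.mass_eq.symm) hp, le_antisymm h1 h2]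
      simp
  cover w hw := by
    obtain ⟨s, hs, u, hu, hp⟩ := hT.cover w hw
    by_cases hm : MeetsInterior A s t
    · obtain ⟨d, hd, hld, hsd⟩ := hT.subset_lower_of_meetsInterior hA htA hc hl hlow hs hm
      obtain ⟨a, -, e, he, hle, hB⟩ := hl.exists_top htA hc
        (hu.mono (hsd.trans (Finset.erase_subset _ _)))
      exact ⟨t.erase e, Or.inr ⟨Finset.card_pos.1 (by rw [Finset.card_erase_of_mem he]; omega),
        e, he, hle, subset_rfl⟩, _, hB, by rw [hl.pt_add, hp]⟩
    · exact ⟨s, Or.inl ⟨hs, hm⟩, u, hu, hp⟩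

/-- The crux is that no other queued `s` reaches below an upper face of `t`. If it did, a point
interior to `s` would lie vertically between two points of `t`, so `s` and `t` would overlap,
contrary to injectivity of the lift. -/
theorem Front.flip (h : Filling A ω K Tu Tv) (hF : Front A ω K Tv T Q) (htQ : t ∈ Q)
    (hl : IsCircuit A ω t l) (hlow : ∀ d ∈ t, 0 < l d → t.erase d ∈ T) :
    Front A ω K Tv (flipFaces A t l T) (Q \ {t}) := by
  classical
  have htA := hF.subset_of_mem h htQ
  obtain ⟨htK, hc⟩ := hF.queue_sub htQ
  have hA := h.gen
  refine ⟨hF.tri.flip hA htA hc hl hlow, ?_, Set.sdiff_subset.trans hF.queue_sub, ?_, ?_⟩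
  · rintro s (⟨hs, -⟩ | ⟨hne, d, -, -, hs⟩)
    exacts [hF.sub hs, h.down t htK s (hs.trans (Finset.erase_subset _ _)) hne]
  · rintro s ⟨hsQ, hst⟩ w hw s' (⟨hs', -⟩ | ⟨-, d, hd, hld, hs'⟩) u hu hp
    · exact hF.above s hsQ w hw s' hs' u hu hp
    by_contra! hlt
    have hsA := hF.subset_of_mem h hsQ
    obtain ⟨hsK, hsc⟩ := hF.queue_sub hsQ
    have hut := hu.mono (hs'.trans (Finset.erase_subset _ _))
    obtain ⟨a, ha, d', hd', hld', hB⟩ := hl.exists_bottom htA hc hut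
    have h1 := hF.above s hsQ w hw _ (hlow d' hd' hld') _ hB (by rw [hl.pt_add, hp])
    rw [hl.ht_add] at h1
    -- a point of `t` strictly above the given point of `s`
    obtain ⟨m, hm, hmpos, hmp, hmh⟩ : ∃ m, IsWeight A t m ∧ (∀ p ∈ t, 0 < m p) ∧
        pt A m = pt A w ∧ ht A ω w < ht A ω m := by
      -- On the vertical segment from `u` down to the lower face, this parameter gives exactly the
      -- height of `w`. The midpoint of that point and `u` is then interior to `t` and strictly
      -- higher.
      have hk := hut.comb (hB.mono (Finset.erase_subset _ _))
        (a := (ht A ω w - ht A ω u) / a)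
        (div_nonneg_of_nonpos (by linarith) ha)
        ((div_le_one_of_neg (by linarith)).2 (by linarith))
      have ha0 : a ≠ 0 := by rintro rfl; linarith
      have hkp : pt A ((1 - (ht A ω w - ht A ω u) / a) • u +
          ((ht A ω w - ht A ω u) / a) • (u + a • l)) = pt A u := by
        rw [map_add, map_smul, map_smul, hl.pt_add, ← add_smul]; simp
      have hkh : ht A ω ((1 - (ht A ω w - ht A ω u) / a) • u +
          ((ht A ω w - ht A ω u) / a) • (u + a • l)) = ht A ω w := by
        rw [map_add, map_smul, map_smul, hl.ht_add]
        simp only [smul_eq_mul]; field_simp; ring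
      obtain ⟨m, h2, h3, h4, h5⟩ := hl.midpoint_pos hA htA hc hk hut hkp
        (fun hh => by rw [hh] at hkh; linarith)
      exact ⟨m, h2, h3, by rw [h4, hkp, hp], by rw [h5, hkh]; linarith⟩
    obtain ⟨c, hcw, hcpos⟩ := exists_weight_pos hsA (Finset.card_pos.1 (by omega))
    -- Both points are moved towards the same spatial point, the barycentre of `s`. They stay on a
    -- common vertical line, and their height difference is only scaled by `1 - e`.
    obtain ⟨c', k0, k1, k2, k3⟩ := hl.exists_coord hA htA hc (pt A c) (ht A ω c)
    obtain ⟨e, he, he1, hep⟩ := exists_perturb t m c' hmpos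
    have hM : IsWeight A t ((1 - e) • m + e • c') :=
      IsWeight.of_nonneg_on (fun p h => (hep p h).le)
        (fun p h => by simp [hm.support p h, k0 p h]) (by simp [hm.mass_eq, k1])
    have hW := hw.comb hcw he.le he1.le
    have he1' : 0 < 1 - e := by linarith
    have hWpos : ∀ p ∈ s, 0 < ((1 - e) • w + e • c) p := fun p hps => by
      have := hw.nonneg p
      have := hcpos p hps
      simp only [Pi.add_apply, Pi.smul_apply, smul_eq_mul]
      positivity
    have hMp : pt A ((1 - e) • m + e • c') = pt A ((1 - e) • w + e • c) := by simp [hmp, k2]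
    have hMh : ht A ω ((1 - e) • w + e • c) < ht A ω ((1 - e) • m + e • c') := by
      simp only [map_add, map_smul, smul_eq_mul, k3]
      nlinarith
    generalize (1 - e) • m + e • c' = M at *
    generalize (1 - e) • w + e • c = W at *
    obtain ⟨b, hb, g, hg, hlg, hD⟩ := hl.exists_bottom htA hc hM
    have h6 := hF.above s hsQ W hW _ (hlow g hg hlg) _ hD (by rw [hl.pt_add, hMp])
    rw [hl.ht_add] at h6
    -- The height of `W` lies between those of the bottom point and of `M`, both in `t`. By
    -- convexity the point of `t`'s frame at that height has nonnegative weights.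
    have hMt : IsWeight A t (M + (ht A ω W - ht A ω M) • l) := by
      refine hl.isWeight_add hM fun p hpt => ?_
      have h7 := hM.nonneg p
      have h8 := hD.nonneg p
      simp only [Pi.add_apply, Pi.smul_apply, smul_eq_mul] at h8
      rcases le_or_gt 0 (l p) with h9 | h9 <;> nlinarith
    have h10 := h.inj s hsK t htK _ _ hW hMt (by rw [hl.pt_add, hMp]) (by rw [hl.ht_add]; ring)
    rw [← h10] at hMt
    exact hst (Finset.eq_of_subset_of_card_le (hMt.subset_of_pos hWpos) (by omega))
  · intro s hs u hu s' hs' v hv hp z hz1 hz2 hz3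
    -- A point above the new section is also above the old one, so the old coverage supplies a
    -- queued tetrahedron. It is not `t`, since `t` has nothing above the new section.
    obtain ⟨s0, hs0, u0, hu0, hp0, hle⟩ : ∃ s0 ∈ T, ∃ u0, IsWeight A s0 u0 ∧ pt A u0 = pt A u ∧
        ht A ω u0 ≤ ht A ω u := by
      obtain ⟨hs, -⟩ | ⟨-, d, hd, hld, hs⟩ := hs
      · exact ⟨s, hs, u, hu, rfl, le_rfl⟩
      · obtain ⟨a, ha, e, he, hle, hB⟩ := hl.exists_bottom htA hc
          (hu.mono (hs.trans (Finset.erase_subset _ _)))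
        exact ⟨_, hlow e he hle, _, hB, hl.pt_add _ _, by rw [hl.ht_add]; linarith⟩
    obtain ⟨t', ht', w, hw, hwp, hwz⟩ := hF.cover s0 hs0 u0 hu0 s' hs' v hv (hp0.trans hp) z
      (hle.trans_lt hz1) hz2 (by rwa [hp0])
    rw [hp0] at hwp
    refine ⟨t', ⟨ht', ?_⟩, w, hw, hwp, hwz⟩
    rintro rfl
    obtain ⟨hs, hm⟩ | ⟨-, d, hd, hld, hs⟩ := hs
    · have := hF.tri.unique_of_not_meetsInterior hA htA hc hl hlow hs hm hu hw hwp.symm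
      rw [this] at hz1
      linarith
    · have := hl.ht_le_of_upper hA htA hc hld (hu.mono hs) hw hwp.symm
      linarith

/-- The triangles of the flipped triangulation. -/
theorem mem_flipFaces_iff (hA : InGeneralPosition A) (htA : t ⊆ A) (hc : t.card = 4)
    (hl : IsCircuit A ω t l) (hT : Tri A T) (hlow : ∀ d ∈ t, 0 < l d → t.erase d ∈ T)
    {f : Finset Plane} (hf : f.card = 3) :
    f ∈ flipFaces A t l T ↔ (f ∈ T ∧ ¬ ∃ d ∈ t, 0 < l d ∧ f = t.erase d) ∨
      ∃ d ∈ t, l d < 0 ∧ f = t.erase d := by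
  classical
  have hsub : ∀ d ∈ t, f ⊆ t.erase d → f = t.erase d := fun d hd h =>
    Finset.eq_of_subset_of_card_le h (by rw [Finset.card_erase_of_mem hd]; omega)
  constructor
  · rintro (⟨hfT, hm⟩ | ⟨-, d, hd, hld, h⟩)
    · refine Or.inl ⟨hfT, ?_⟩
      rintro ⟨d, hd, hld, rfl⟩
      obtain ⟨w, hw, -, e, he, hwe, hpos⟩ := hl.exists_inward htA hc hd hld
      exact hm ⟨w, _, hw, hwe, hpos, (hl.pt_add w e).symm⟩
    · exact Or.inr ⟨d, hd, hld, hsub d hd h⟩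
  · rintro (⟨hfT, hm⟩ | ⟨d, hd, hld, rfl⟩)
    · refine Or.inl ⟨hfT, fun hmi => hm ?_⟩
      obtain ⟨d, hd, hld, h⟩ := hT.subset_lower_of_meetsInterior hA htA hc hl hlow hfT hmi
      exact ⟨d, hd, hld, hsub d hd h⟩
    · exact Or.inr ⟨Finset.card_pos.1 (by omega), d, hd, hld, subset_rfl⟩

end Flip

end

/-! ### Translation between simplicial complexes and weights -/

section Bridge

variable {A : Finset Plane} {ω : Plane → ℝ}

theorem mem_convexHull_iff_weight {s : Finset Plane} (hs : s ⊆ A) {x : Plane} :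
    x ∈ convexHull ℝ (s : Set Plane) ↔ ∃ w, IsWeight A s w ∧ pt A w = x := by
  classical
  rw [Finset.mem_convexHull']
  constructor
  · rintro ⟨w, h0, h1, h2⟩
    refine ⟨fun p => if p ∈ s then w p else 0, IsWeight.of_nonneg_on (fun p hp => by simp [hp, h0])
      (fun p hp => by simp [hp]) ?_, ?_⟩
    · rw [mass_apply, Finset.sum_ite_mem, Finset.inter_eq_right.2 hs, h1]
    · simp_rw [pt_apply, ite_smul, zero_smul]
      rw [Finset.sum_ite_mem, Finset.inter_eq_right.2 hs, h2]
  · rintro ⟨w, hw, rfl⟩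
    refine ⟨w, fun p _ => hw.nonneg p, ?_, ?_⟩
    · rw [← hw.mass_eq, mass_apply, ← Finset.sum_subset hs fun p _ hp => hw.support p hp]
    · rw [pt_apply, ← Finset.sum_subset hs fun p _ hp => by rw [hw.support p hp, zero_smul]]

theorem mem_convexHull_lift_iff {s : Finset Plane} (hs : s ⊆ A) {q : Space} :
    q ∈ convexHull ℝ (liftSimplex ω s : Set Space) ↔
      ∃ w, IsWeight A s w ∧ pt A w = q.1 ∧ ht A ω w = q.2 := by
  classical
  rw [Finset.mem_convexHull']
  constructor
  · rintro ⟨w, h0, h1, h2⟩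
    simp only [liftSimplex, Finset.sum_map, Finset.mem_map] at h0 h1 h2
    refine ⟨fun p => if p ∈ s then w (liftMap ω p) else 0, IsWeight.of_nonneg_on
      (fun p hp => by simpa [hp] using h0 _ ⟨p, hp, rfl⟩) (fun p hp => by simp [hp]) ?_, ?_, ?_⟩
    · rw [mass_apply, Finset.sum_ite_mem, Finset.inter_eq_right.2 hs, h1]
    · simp_rw [pt_apply, ite_smul, zero_smul]
      rw [Finset.sum_ite_mem, Finset.inter_eq_right.2 hs, ← h2, Prod.fst_sum]
      rfl
    · simp_rw [ht_apply, ite_mul, zero_mul]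
      rw [Finset.sum_ite_mem, Finset.inter_eq_right.2 hs, ← h2, Prod.snd_sum]
      rfl
  · rintro ⟨w, hw, hp, hh⟩
    refine ⟨fun q => w q.1, fun q _ => hw.nonneg _, ?_, ?_⟩
    · rw [liftSimplex, Finset.sum_map, ← hw.mass_eq, mass_apply,
        ← Finset.sum_subset hs fun p _ hp => hw.support p hp]
      rfl
    · rw [liftSimplex, Finset.sum_map]
      refine Prod.ext ?_ ?_
      · rw [Prod.fst_sum, ← hp, pt_apply,
          ← Finset.sum_subset hs fun p _ hp => by rw [hw.support p hp, zero_smul]]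
        rfl
      · rw [Prod.snd_sum, ← hh, ht_apply,
          ← Finset.sum_subset hs fun p _ hp => by rw [hw.support p hp, zero_mul]]
        rfl

theorem weight_eq_of_affineIndependent {s : Finset Plane} (hs : s ⊆ A)
    (hi : AffineIndependent ℝ ((↑) : {p // p ∈ s} → Plane)) {w w' : Plane → ℝ}
    (hw : IsWeight A s w) (hw' : IsWeight A s w') (hp : pt A w = pt A w') : w = w' := by
  classical
  rw [affineIndependent_iff] at hi
  have h1 : ∀ p, p ∉ s → (w - w') p = 0 := fun p hp => by simp [hw.support p hp, hw'.support p hp]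
  have h2 : mass A (w - w') = 0 := by simp [hw.mass_eq, hw'.mass_eq]
  have h3 : pt A (w - w') = 0 := by simp [hp]
  rw [mass_apply, ← Finset.sum_subset hs fun p _ hp => h1 p hp, ← Finset.sum_coe_sort] at h2
  rw [pt_apply, ← Finset.sum_subset hs fun p _ hp => by rw [h1 p hp, zero_smul],
    ← Finset.sum_coe_sort] at h3
  have h4 := hi Finset.univ (fun i => (w - w') i) h2 h3
  refine sub_eq_zero.1 (funext fun p => ?_)
  by_cases hps : p ∈ s
  exacts [h4 ⟨p, hps⟩ (Finset.mem_univ _), h1 p hps]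

theorem weight_eq_of_affineIndependent_lift {s : Finset Plane} (hs : s ⊆ A)
    (hi : AffineIndependent ℝ ((↑) : {q // q ∈ liftSimplex ω s} → Space)) {w w' : Plane → ℝ}
    (hw : IsWeight A s w) (hw' : IsWeight A s w') (hp : pt A w = pt A w')
    (hh : ht A ω w = ht A ω w') : w = w' := by
  classical
  rw [affineIndependent_iff] at hi
  have h1 : ∀ p, p ∉ s → (w - w') p = 0 := fun p hp => by simp [hw.support p hp, hw'.support p hp]
  have h2 : mass A (w - w') = 0 := by simp [hw.mass_eq, hw'.mass_eq]
  have h3 : pt A (w - w') = 0 := by simp [hp]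
  have h3' : ht A ω (w - w') = 0 := by simp [hh]
  rw [mass_apply, ← Finset.sum_subset hs fun p _ hp => h1 p hp] at h2
  rw [pt_apply, ← Finset.sum_subset hs fun p _ hp => by rw [h1 p hp, zero_smul]] at h3
  rw [ht_apply, ← Finset.sum_subset hs fun p _ hp => by rw [h1 p hp, zero_mul]] at h3'
  have h4 := hi Finset.univ (fun i => (w - w') i.1.1)
    (by rw [Finset.sum_coe_sort (liftSimplex ω s) (fun q => (w - w') q.1), liftSimplex,
          Finset.sum_map]
        exact h2)
    (by rw [Finset.sum_coe_sort (liftSimplex ω s) (fun q => (w - w') q.1 • q), liftSimplex,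
          Finset.sum_map]
        refine Prod.ext ?_ ?_
        · rw [Prod.fst_sum]; exact h3
        · rw [Prod.snd_sum]; exact h3')
  refine sub_eq_zero.1 (funext fun p => ?_)
  by_cases hps : p ∈ s
  exacts [h4 ⟨liftMap ω p, Finset.mem_map_of_mem _ hps⟩ (Finset.mem_univ _), h1 p hps]

theorem IsWeight.inter [DecidableEq Plane] {s s' : Finset Plane} {w : Plane → ℝ}
    (h : IsWeight A s w) (h' : IsWeight A s' w) : IsWeight A (s ∩ s') w :=
  ⟨h.nonneg, fun p hp => by
    by_cases hps : p ∈ s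
    · exact h'.support p fun h2 => hp (Finset.mem_inter.2 ⟨hps, h2⟩)
    · exact h.support p hps, h.mass_eq⟩

theorem IsTriangulation.tri {T : SimplicialComplex ℝ Plane} (h : IsTriangulation A T) :
    Tri A T.faces := by
  classical
  have hsub : ∀ s ∈ T.faces, s ⊆ A := fun s hs p hp => by
    have : p ∈ T.vertices := T.down_closed hs (Finset.singleton_subset_iff.2 hp)
      (Finset.singleton_nonempty _)
    exact_mod_cast h.1 this
  refine ⟨hsub, fun s hs => T.nonempty_of_mem_faces hs, fun s hs s' hss hne =>
    T.down_closed hs hss hne, ?_, ?_⟩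
  · intro s hs s' hs' w w' hw hw' hp
    have hx := T.inter_subset_convexHull hs hs'
      ⟨(mem_convexHull_iff_weight (hsub s hs)).2 ⟨w, hw, rfl⟩,
        (mem_convexHull_iff_weight (hsub s' hs')).2 ⟨w', hw', hp.symm⟩⟩
    rw [← Finset.coe_inter, mem_convexHull_iff_weight
      (Finset.inter_subset_left.trans (hsub s hs))] at hx
    obtain ⟨u, hu, hup⟩ := hx
    rw [weight_eq_of_affineIndependent (hsub s hs) (T.indep hs) hw
        (hu.mono Finset.inter_subset_left) hup.symm,
      weight_eq_of_affineIndependent (hsub s' hs') (T.indep hs') hw'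
        (hu.mono Finset.inter_subset_right) (hp.symm.trans hup.symm)]
  · intro w hw
    have hx : pt A w ∈ T.space := by
      rw [h.2]; exact (mem_convexHull_iff_weight subset_rfl).2 ⟨w, hw, rfl⟩
    obtain ⟨s, hs, hxs⟩ := SimplicialComplex.mem_space_iff.1 hx
    exact ⟨s, hs, (mem_convexHull_iff_weight (hsub s hs)).1 hxs⟩

/-- Shifting the barycentre by a small multiple of an affine relation gives another weight for the
same point, so injectivity forces the relation to be trivial. -/
theorem Tri.affineIndependent {F : Set (Finset Plane)} (h : Tri A F) {s : Finset Plane}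
    (hs : s ∈ F) : AffineIndependent ℝ ((↑) : {p // p ∈ s} → Plane) := by
  classical
  have hsA := h.subset s hs
  rw [affineIndependent_iff_of_fintype]
  intro m hm0 hm1 i
  rw [Finset.weightedVSub_eq_linear_combination _ hm0] at hm1
  set l : Plane → ℝ := fun p => if h : p ∈ s then m ⟨p, h⟩ else 0 with hl
  have hm : mass A l = 0 := by
    rw [mass_apply, ← Finset.sum_subset hsA fun p _ hp => by simp [hl, hp], ← Finset.sum_coe_sort]
    simpa [hl] using hm0
  have hp : pt A l = 0 := by
    rw [pt_apply, ← Finset.sum_subset hsA fun p _ hp => by simp [hl, hp], ← Finset.sum_coe_sort]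
    simpa [hl] using hm1
  obtain ⟨w, hw, hpos⟩ := exists_weight_pos hsA (h.nonempty s hs)
  obtain ⟨e, he, -, hep⟩ := exists_perturb s w (w + l) hpos
  have heq : (1 - e) • w + e • (w + l) = w + e • l := by
    rw [smul_add, ← add_assoc, ← add_smul, sub_add_cancel, one_smul]
  rw [heq] at hep
  have hw' : IsWeight A s (w + e • l) := IsWeight.of_nonneg_on (fun p h => (hep p h).le)
    (fun p h => by simp [hw.support p h, hl, h]) (by simp [hw.mass_eq, hm])
  have h1 := h.inj s hs s hs _ _ hw' hw (by simp [hp])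
  rw [add_eq_left] at h1
  simpa [hl] using congrFun ((smul_eq_zero.1 h1).resolve_left he.ne') i

/-- Weight data of a triangulation determine a geometric simplicial complex. -/
theorem Tri.exists_complex {F : Set (Finset Plane)} (h : Tri A F) :
    ∃ T : SimplicialComplex ℝ Plane, T.faces = F ∧ IsTriangulation A T := by
  classical
  refine ⟨{ faces := F
            isRelLowerSet_faces := fun s hs => ⟨h.nonempty s hs, fun s' hss hne =>
              h.down s hs s' hss hne⟩
            indep := fun hs => h.affineIndependent hs
            inter_subset_convexHull := ?_ }, rfl, ?_, ?_⟩
  · rintro s s' hs hs' x ⟨hx, hx'⟩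
    obtain ⟨w, hw, rfl⟩ := (mem_convexHull_iff_weight (h.subset s hs)).1 hx
    obtain ⟨w', hw', hp⟩ := (mem_convexHull_iff_weight (h.subset s' hs')).1 hx'
    have := h.inj s' hs' s hs w' w hw' hw hp
    subst this
    rw [← Finset.coe_inter]
    exact (mem_convexHull_iff_weight (Finset.inter_subset_left.trans (h.subset s hs))).2
      ⟨_, hw.inter hw', rfl⟩
  · intro p hp
    have := h.subset _ hp (Finset.mem_singleton_self p)
    exact_mod_cast this
  · ext x
    rw [SimplicialComplex.mem_space_iff, mem_convexHull_iff_weight subset_rfl]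
    constructor
    · rintro ⟨s, hs, hx⟩
      obtain ⟨w, hw, rfl⟩ := (mem_convexHull_iff_weight (h.subset s hs)).1 hx
      exact ⟨w, hw.full (h.subset s hs), rfl⟩
    · rintro ⟨w, hw, rfl⟩
      obtain ⟨s, hs, u, hu, hp⟩ := h.cover w hw
      exact ⟨s, hs, (mem_convexHull_iff_weight (h.subset s hs)).2 ⟨u, hu, hp⟩⟩

theorem mem_charSection_iff {T : SimplicialComplex ℝ Plane} (h : IsTriangulation A T) {q : Space} :
    q ∈ charSection ω T ↔ ∃ s ∈ T.faces, ∃ w, IsWeight A s w ∧ pt A w = q.1 ∧ ht A ω w = q.2 := by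
  simp only [charSection, Set.mem_iUnion, exists_prop]
  refine exists_congr fun s => and_congr_right fun hs => ?_
  exact mem_convexHull_lift_iff (h.tri.subset s hs)

/-- The planar projections of the faces of `K`. -/
def projFaces (ω : Plane → ℝ) (K : SimplicialComplex ℝ Space) : Set (Finset Plane) :=
  {s | liftSimplex ω s ∈ K.faces}

theorem tetrahedra_eq (K : SimplicialComplex ℝ Space) :
    tetrahedra ω K = tets (projFaces ω K) := by
  ext t
  exact and_comm

/-- Without Steiner points every face of `K` is the lift of a subset of `A`, so projecting vertices
loses nothing. A common point of two simplices lies in their common face, which with affine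
independence gives injectivity. Uniqueness of planar weights turns the bounds of the polyhedron into
height inequalities. -/
theorem IsSteinerFreeTetrahedralisation.filling {Tu Tv : SimplicialComplex ℝ Plane}
    {K : SimplicialComplex ℝ Space} (hA : InGeneralPosition A) (hTu : IsTriangulation A Tu)
    (hTv : IsTriangulation A Tv) (h : IsSteinerFreeTetrahedralisation ω Tu Tv K) :
    Filling A ω (projFaces ω K) Tu.faces Tv.faces := by
  classical
  have hvert : ∀ σ ∈ K.faces, ∀ q ∈ σ, ∃ p ∈ A, liftMap ω p = q := fun σ hσ q hq => by
    have hv : q ∈ K.vertices := K.down_closed hσ (Finset.singleton_subset_iff.2 hq)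
      (Finset.singleton_nonempty _)
    rw [h.vertices_eq] at hv
    obtain ⟨p, hp | hp, rfl⟩ := hv
    exacts [⟨p, by exact_mod_cast hTu.1 hp, rfl⟩, ⟨p, by exact_mod_cast hTv.1 hp, rfl⟩]
  have hsub : ∀ s ∈ projFaces ω K, s ⊆ A := fun s hs p hp => by
    obtain ⟨p', hp', he⟩ := hvert _ hs _ (Finset.mem_map_of_mem (liftMap ω) hp)
    rwa [← (liftMap ω).injective he]
  have hproj : ∀ σ ∈ K.faces, ∃ s ∈ projFaces ω K, liftSimplex ω s = σ := fun σ hσ => by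
    have : liftSimplex ω (σ.image Prod.fst) = σ := by
      ext q
      simp only [liftSimplex, Finset.mem_map, Finset.mem_image]
      constructor
      · rintro ⟨p, ⟨q', hq', rfl⟩, rfl⟩
        obtain ⟨p, -, rfl⟩ := hvert σ hσ q' hq'
        exact hq'
      · intro hq
        obtain ⟨p, -, rfl⟩ := hvert σ hσ q hq
        exact ⟨p, ⟨_, hq, rfl⟩, rfl⟩
    exact ⟨_, by rw [projFaces, Set.mem_ofPred_eq, this]; exact hσ, this⟩
  have hspace : ∀ s ∈ projFaces ω K, ∀ w, IsWeight A s w →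
      (pt A w, ht A ω w) ∈ polyhedronBetween ω Tu Tv := fun s hs w hw => by
    rw [← h.space_eq, SimplicialComplex.mem_space_iff]
    exact ⟨_, hs, (mem_convexHull_lift_iff (hsub s hs)).2 ⟨w, hw, rfl, rfl⟩⟩
  refine ⟨hA, hTu.tri, hTv.tri, hsub, ?_, ?_, ?_, fun s hs => h.lower_faces s hs,
    fun s hs => h.upper_faces s hs, ?_, ?_, ?_⟩
  · intro s hs s' hss hne
    exact K.down_closed hs (Finset.map_subset_map.2 hss) (hne.map)
  · intro s hs
    have h1 := (K.indep hs).card_le_finrank_succ.trans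
      (Nat.add_le_add_right (Submodule.finrank_le _) 1)
    have h2 : Module.finrank ℝ Space = 3 := by simp
    rwa [h2, Fintype.card_coe, liftSimplex, Finset.card_map] at h1
  · intro s hs s' hs' w w' hw hw' hp hh
    have hx := K.inter_subset_convexHull hs hs'
      ⟨(mem_convexHull_lift_iff (hsub s hs) (q := (pt A w, ht A ω w))).2 ⟨w, hw, rfl, rfl⟩,
        (mem_convexHull_lift_iff (hsub s' hs')).2 ⟨w', hw', hp.symm, hh.symm⟩⟩
    have hI : (liftSimplex ω s : Set Space) ∩ (liftSimplex ω s' : Set Space) =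
        (liftSimplex ω (s ∩ s') : Set Space) := by
      rw [← Finset.coe_inter, liftSimplex, liftSimplex, liftSimplex, Finset.map_inter]
    rw [hI, mem_convexHull_lift_iff (Finset.inter_subset_left.trans (hsub s hs))] at hx
    obtain ⟨u, hu, hup, huh⟩ := hx
    rw [weight_eq_of_affineIndependent_lift (hsub s hs) (K.indep hs) hw
        (hu.mono Finset.inter_subset_left) hup.symm huh.symm,
      weight_eq_of_affineIndependent_lift (hsub s' hs') (K.indep hs') hw'
        (hu.mono Finset.inter_subset_right) (hp.symm.trans hup.symm) (hh.symm.trans huh.symm)]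
  · intro s hs w hw s' hs' u hu hp
    obtain ⟨z₁, z₂, h1, -, h3, -⟩ := hspace s hs w hw
    obtain ⟨r, hr, v, hv, hvp, hvh⟩ := (mem_charSection_iff hTu).1 h1
    rw [hTu.tri.inj s' hs' r hr u v hu hv (hp.trans hvp.symm), hvh]
    exact h3
  · intro s hs w hw s' hs' u hu hp
    obtain ⟨z₁, z₂, -, h1, -, h3⟩ := hspace s hs w hw
    obtain ⟨r, hr, v, hv, hvp, hvh⟩ := (mem_charSection_iff hTv).1 h1
    rw [hTv.tri.inj s' hs' r hr u v hu hv (hp.trans hvp.symm), hvh]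
    exact h3
  · intro s hs u hu s' hs' v hv hp z h1 h2
    have hz : (pt A u, z) ∈ K.space := by
      rw [h.space_eq]
      exact ⟨_, _, (mem_charSection_iff hTu).2 ⟨s, hs, u, hu, rfl, rfl⟩,
        (mem_charSection_iff hTv).2 ⟨s', hs', v, hv, hp.symm, rfl⟩, h1, h2⟩
    obtain ⟨σ, hσ, hzσ⟩ := SimplicialComplex.mem_space_iff.1 hz
    obtain ⟨r, hr, rfl⟩ := hproj σ hσ
    exact ⟨r, hr, (mem_convexHull_lift_iff (hsub r hr)).1 hzσ⟩

end Bridge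

/-! ### Lower faces, upper faces and removability by circuit signs -/

section Flips

variable {A : Finset Plane} {ω : Plane → ℝ} {t : Finset Plane} {l : Plane → ℝ}

theorem exists_eq_erase {f : Finset Plane} [DecidableEq Plane] (hf : f ⊆ t) (hf3 : f.card = 3)
    (hc : t.card = 4) : ∃ d ∈ t, f = t.erase d := by
  have h1 : (t \ f).card = 1 := by rw [Finset.card_sdiff_of_subset hf]; omega
  obtain ⟨d, hd⟩ := Finset.card_eq_one.1 h1
  have hdt : d ∈ t \ f := by simp [hd]
  rw [Finset.mem_sdiff] at hdt
  refine ⟨d, hdt.1, Finset.eq_of_subset_of_card_le (fun p hp => Finset.mem_erase.2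
    ⟨fun h => hdt.2 (h ▸ hp), hf hp⟩) (by rw [Finset.card_erase_of_mem hdt.1]; omega)⟩

/-- An affine function pairs with the circuit to zero. -/
theorem IsCircuit.ht_affine (hl : IsCircuit A ω t l) (h : Plane →ᵃ[ℝ] ℝ) : ht A h l = 0 := by
  have h1 : ∀ p, h p = h.linear p + h 0 := fun p => congrFun h.decomp p
  have h2 := congrArg h.linear hl.pt_eq
  have h3 := hl.mass_eq
  rw [pt_apply, map_sum, map_zero] at h2
  rw [mass_apply] at h3
  simp only [map_smul, smul_eq_mul] at h2
  rw [ht_apply]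
  rw [Finset.sum_congr rfl fun p _ => by rw [h1 p, mul_add], Finset.sum_add_distrib, h2,
    ← Finset.sum_mul, h3, zero_mul, zero_add]

/-- Pairing `l` with `ω - h` gives 1, since affine functions pair to zero, and only the vertex `d`
contributes. So the sign of `l d` tells on which side of the plane through the opposite face the
lift of `d` lies. -/
theorem IsCircuit.mul_sub_eq_one [DecidableEq Plane] (htA : t ⊆ A) (hl : IsCircuit A ω t l)
    {d : Plane} (hd : d ∈ t) {h : Plane →ᵃ[ℝ] ℝ} (hh : ∀ p ∈ t.erase d, h p = ω p) :
    l d * (ω d - h d) = 1 := by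
  have h1 := hl.ht_affine h
  have h2 := hl.ht_eq
  have h3 : ∑ p ∈ A, l p * (ω p - h p) = 1 := by
    simp_rw [mul_sub, Finset.sum_sub_distrib]
    rw [← ht_apply, ← ht_apply, h1, h2, sub_zero]
  rwa [Finset.sum_eq_single_of_mem d (htA hd)] at h3
  intro p _ hpd
  by_cases hp : p ∈ t
  · rw [hh p (Finset.mem_erase.2 ⟨hpd, hp⟩), sub_self, mul_zero]
  · rw [hl.support p hp, zero_mul]

theorem InGeneralPosition.exists_affine (hA : InGeneralPosition A) {f : Finset Plane}
    (hf : f ⊆ A) (hc : f.card = 3) (ω : Plane → ℝ) :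
    ∃ h : Plane →ᵃ[ℝ] ℝ, ∀ p ∈ f, h p = ω p := by
  classical
  obtain ⟨b, hb⟩ := hA.exists_basis hf hc
  refine ⟨∑ i : {p // p ∈ f}, ω i • b.coord i, fun p hp => ?_⟩
  have h1 : ∀ i, b.coord i p = if i = ⟨p, hp⟩ then 1 else 0 := fun i => by
    conv_lhs => rw [show p = b ⟨p, hp⟩ from (hb ⟨p, hp⟩).symm]
    exact b.coord_apply i _
  have h2 : (∑ i : {p // p ∈ f}, ω i • b.coord i : Plane →ᵃ[ℝ] ℝ) p = ∑ i : {p // p ∈ f}, ω i * b.coord i p := by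
    generalize (Finset.univ : Finset {p // p ∈ f}) = S
    induction S using Finset.induction_on with
    | empty => simp
    | insert a S ha ih => rw [Finset.sum_insert ha, Finset.sum_insert ha, ← ih]; rfl
  rw [h2]
  simp [h1]

theorem isLowerFace_iff [DecidableEq Plane] (hA : InGeneralPosition A) (htA : t ⊆ A)
    (hc : t.card = 4) (hl : IsCircuit A ω t l) {f : Finset Plane} :
    IsLowerFace ω t f ↔ ∃ d ∈ t, 0 < l d ∧ f = t.erase d := by
  constructor
  · rintro ⟨hf, hf3, h, h1, h2⟩
    obtain ⟨d, hd, rfl⟩ := exists_eq_erase hf hf3 hc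
    refine ⟨d, hd, ?_, rfl⟩
    have h3 := hl.mul_sub_eq_one htA hd h1
    have h4 := h2 d hd (by simp)
    by_contra! h5
    nlinarith
  · rintro ⟨d, hd, hld, rfl⟩
    have hc3 : (t.erase d).card = 3 := by rw [Finset.card_erase_of_mem hd, hc]
    obtain ⟨h, hh⟩ := hA.exists_affine ((Finset.erase_subset d t).trans htA) hc3 ω
    refine ⟨Finset.erase_subset _ _, hc3, h, hh, fun p hp hpe => ?_⟩
    obtain rfl : p = d := by
      by_contra hpd
      exact hpe (Finset.mem_erase.2 ⟨hpd, hp⟩)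
    have h3 := hl.mul_sub_eq_one htA hd hh
    by_contra! h5
    nlinarith

theorem isLowerFace_neg {f : Finset Plane} : IsLowerFace (-ω) t f ↔ IsUpperFace ω t f := by
  refine and_congr_right fun _ => and_congr_right fun _ => ⟨?_, ?_⟩ <;>
  · rintro ⟨h, h1, h2⟩
    refine ⟨-h, fun p hp => ?_, fun p hp hpf => ?_⟩
    · have := h1 p hp
      simp only [AffineMap.coe_neg, Pi.neg_apply] at *
      linarith
    · have := h2 p hp hpf
      simp only [AffineMap.coe_neg, Pi.neg_apply] at *
      linarith

theorem isUpperFace_iff [DecidableEq Plane] (hA : InGeneralPosition A) (htA : t ⊆ A)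
    (hc : t.card = 4) (hl : IsCircuit A ω t l) {f : Finset Plane} :
    IsUpperFace ω t f ↔ ∃ d ∈ t, l d < 0 ∧ f = t.erase d := by
  rw [← isLowerFace_neg, isLowerFace_iff hA htA hc hl.neg]
  simp

/-- A point with positive weights is interior to its triangle. -/
theorem InGeneralPosition.mem_interior (hA : InGeneralPosition A) {f : Finset Plane}
    (hf : f ⊆ A) (hc : f.card = 3) {w : Plane → ℝ} (hw : IsWeight A f w)
    (hpos : ∀ p ∈ f, 0 < w p) : pt A w ∈ interior (convexHull ℝ (f : Set Plane)) := by
  classical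
  obtain ⟨b, hb⟩ := hA.exists_basis hf hc
  have hr : (f : Set Plane) = Set.range b := by
    ext p
    simp [hb]
  rw [hr, b.interior_convexHull]
  intro i
  have h1 : pt A w = Finset.univ.affineCombination ℝ b (fun i => w i) := by
    rw [Finset.affineCombination_eq_linear_combination, pt_apply,
      ← Finset.sum_subset hf fun p _ hp => by rw [hw.support p hp, zero_smul],
      ← Finset.sum_coe_sort]
    · simp [hb]
    · rw [Finset.sum_coe_sort f w, ← hw.mass_eq, mass_apply]
      exact Finset.sum_subset hf fun p _ hp => hw.support p hp
  rw [h1, b.coord_apply_combination_of_mem (Finset.mem_univ i)]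
  · exact hpos i i.2
  · rw [Finset.sum_coe_sort f w, ← hw.mass_eq, mass_apply]
    exact Finset.sum_subset hf fun p _ hp => hw.support p hp

theorem isWeight_single {d : Plane} (hd : d ∈ A) [DecidableEq Plane] :
    IsWeight A {d} (Pi.single d 1) ∧ pt A (Pi.single d 1) = d := by
  refine ⟨IsWeight.of_nonneg_on (fun p hp => ?_) (fun p hp => ?_) ?_, ?_⟩
  · rw [Finset.mem_singleton.1 hp]; simp
  · simp only [Finset.mem_singleton] at hp; simp [hp]
  · rw [mass_apply, Finset.sum_eq_single_of_mem d hd fun p _ hp => by simp [hp]]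
    simp
  · rw [pt_apply, Finset.sum_eq_single_of_mem d hd fun p _ hp => by simp [hp]]
    simp

/-- Solving the dependence for `d` writes it as a combination of the other vertices with
coefficients `-l p / l d`. -/
theorem IsCircuit.exists_weight_erase [DecidableEq Plane] (htA : t ⊆ A)
    (hl : IsCircuit A ω t l) {d : Plane} (hd : d ∈ t) (hs : ∀ p ∈ t.erase d, l p * l d < 0) :
    ∃ w, IsWeight A (t.erase d) w ∧ (∀ p ∈ t.erase d, 0 < w p) ∧ pt A w = d := by
  obtain ⟨h1, h2⟩ := isWeight_single (htA hd)
  have hld := hl.ne_zero d hd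
  have hpos : ∀ p ∈ t.erase d, 0 < (Pi.single d 1 - (l d)⁻¹ • l : Plane → ℝ) p := fun p hp => by
    have h3 := hs p hp
    have h4 : (l d)⁻¹ * l p = l p * l d / (l d) ^ 2 := by field_simp
    simp only [Pi.sub_apply, Pi.smul_apply, smul_eq_mul, Finset.ne_of_mem_erase hp, ne_eq,
      not_false_eq_true, Pi.single_eq_of_ne, h4, zero_sub, Left.neg_pos_iff]
    exact div_neg_of_neg_of_pos h3 (by positivity)
  refine ⟨_, IsWeight.of_nonneg_on (fun p hp => (hpos p hp).le) (fun p hp => ?_) ?_, hpos, ?_⟩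
  · by_cases hpd : p = d
    · subst hpd; simp [hld]
    · simp [hpd, hl.support p fun h => hp (Finset.mem_erase.2 ⟨hpd, h⟩)]
  · simp [h1.mass_eq, hl.mass_eq]
  · simp [h2, hl.pt_eq]

/-- A vertex of the tetrahedron projects into the hull of the opposite face exactly if its sign in
the circuit is opposite to the three others. -/
theorem IsCircuit.mem_convexHull_erase_iff [DecidableEq Plane] (hA : InGeneralPosition A)
    (htA : t ⊆ A) (hc : t.card = 4) (hl : IsCircuit A ω t l) {d : Plane} (hd : d ∈ t) :
    d ∈ convexHull ℝ (↑(t.erase d) : Set Plane) ↔ ∀ p ∈ t.erase d, l p * l d < 0 := by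
  rw [mem_convexHull_iff_weight ((Finset.erase_subset d t).trans htA)]
  constructor
  · rintro ⟨w, hw, hp⟩ p hpe
    obtain ⟨h1, h2⟩ := isWeight_single (htA hd)
    have h := hl.eq_add_smul hA htA hc (hw.mono (Finset.erase_subset _ _)).support
      (h1.mono (Finset.singleton_subset_iff.2 hd)).support (hw.mass_eq.trans h1.mass_eq.symm)
      (hp.trans h2.symm)
    generalize ht A ω (Pi.single d 1) - ht A ω w = a at h
    have h3 := congrFun h d
    have h4 := congrFun h p
    simp only [Pi.add_apply, Pi.smul_apply, smul_eq_mul, Pi.single_eq_same,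
      hw.support d (by simp), zero_add] at h3
    simp only [Pi.add_apply, Pi.smul_apply, smul_eq_mul, ne_eq, Finset.ne_of_mem_erase hpe,
      not_false_eq_true, Pi.single_eq_of_ne] at h4
    have h5 := hw.nonneg p
    have h6 : a * l p ≤ 0 := by linarith
    have h7 : l p * l d ≠ 0 := mul_ne_zero (hl.ne_zero p (Finset.mem_of_mem_erase hpe))
      (hl.ne_zero d hd)
    refine lt_of_le_of_ne ?_ h7
    -- By `h3`, `1 = a * l d`, so `a` has the sign of `l d`.
    have h8 : l p * l d = (a * l p) * (l d) ^ 2 := by linear_combination (l p * l d) * h3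
    rw [h8]
    exact mul_nonpos_of_nonpos_of_nonneg h6 (sq_nonneg _)
  · intro hs
    obtain ⟨w, hw, -, hp⟩ := hl.exists_weight_erase htA hd hs
    exact ⟨w, hw, hp⟩

theorem IsCircuit.mem_interior [DecidableEq Plane] (hA : InGeneralPosition A)
    (htA : t ⊆ A) (hc : t.card = 4) (hl : IsCircuit A ω t l) {d : Plane} (hd : d ∈ t)
    (hs : ∀ p ∈ t.erase d, l p * l d < 0) :
    d ∈ interior (convexHull ℝ (↑(t.erase d) : Set Plane)) := by
  obtain ⟨w, hw, hpos, hp⟩ := hl.exists_weight_erase htA hd hs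
  have := hA.mem_interior ((Finset.erase_subset d t).trans htA)
    (by rw [Finset.card_erase_of_mem hd, hc]) hw hpos
  rwa [hp] at this

/-- The exposed faces correspond to the vertices opposite to them. -/
theorem exposedFaces_eq [DecidableEq Plane] (hc : t.card = 4) (T : Set (Finset Plane))
    [DecidablePred fun d => t.erase d ∈ T] :
    exposedFaces T t = ((t.filter fun d => t.erase d ∈ T).image t.erase : Finset (Finset Plane)) := by
  ext f
  simp only [exposedFaces, Set.mem_ofPred_eq, Finset.coe_image, Finset.coe_filter, Set.mem_image]
  constructor
  · rintro ⟨hf, hf3, hT⟩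
    obtain ⟨d, hd, rfl⟩ := exists_eq_erase hf hf3 hc
    exact ⟨d, ⟨hd, hT⟩, rfl⟩
  · rintro ⟨d, ⟨hd, hT⟩, rfl⟩
    exact ⟨Finset.erase_subset _ _, by rw [Finset.card_erase_of_mem hd, hc], hT⟩

theorem ncard_exposedFaces [DecidableEq Plane] (hc : t.card = 4) (T : Set (Finset Plane))
    [DecidablePred fun d => t.erase d ∈ T] :
    (exposedFaces T t).ncard = (t.filter fun d => t.erase d ∈ T).card := by
  rw [exposedFaces_eq hc, Set.ncard_coe_finset, Finset.card_image_of_injOn]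
  exact (Finset.erase_injOn t).mono fun d hd => (Finset.mem_filter.1 hd).1

/-- Convex position means that no vertex lies in the hull of the other three, that is, no vertex is
alone with its sign. -/
theorem IsCircuit.convexIndependent_iff [DecidableEq Plane] (hA : InGeneralPosition A)
    (htA : t ⊆ A) (hc : t.card = 4) (hl : IsCircuit A ω t l) :
    ConvexIndependent ℝ ((↑) : {p // p ∈ t} → Plane) ↔
      ∀ d ∈ t, ∃ p ∈ t.erase d, 0 < l p * l d := by
  have h1 : ConvexIndependent ℝ ((↑) : {p // p ∈ t} → Plane) ↔
      ∀ d ∈ t, d ∉ convexHull ℝ (↑(t.erase d) : Set Plane) := by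
    simp only [Finset.coe_erase]
    exact convexIndependent_set_iff_notMem_convexHull_sdiff (s := (t : Set Plane))
  rw [h1]
  refine forall₂_congr fun d hd => ?_
  rw [hl.mem_convexHull_erase_iff hA htA hc hd]
  push Not
  refine exists_congr fun p => and_congr_right fun hp => ⟨fun h => h.lt_of_ne ?_, le_of_lt⟩
  exact (mul_ne_zero (hl.ne_zero p (Finset.mem_of_mem_erase hp)) (hl.ne_zero d hd)).symm

theorem IsCircuit.card_pos_lt [DecidableEq Plane] (htA : t ⊆ A) (hc : t.card = 4)
    (hl : IsCircuit A ω t l) [DecidablePred fun d => 0 < l d] :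
    (t.filter fun d => 0 < l d).card ≤ 3 := by
  obtain ⟨d, hd, hn⟩ := hl.exists_neg htA hc
  have : (t.filter fun d => 0 < l d) ⊆ t.erase d := fun p hp => by
    rw [Finset.mem_filter] at hp
    refine Finset.mem_erase.2 ⟨?_, hp.1⟩
    rintro rfl
    linarith [hp.2]
  have := Finset.card_le_card this
  rw [Finset.card_erase_of_mem hd] at this
  omega

/-- If removability sees only lower faces, then it sees all of them. -/
theorem IsCircuit.exposed_of_removable [DecidableEq Plane] (hA : InGeneralPosition A)
    (htA : t ⊆ A) (hc : t.card = 4) (hl : IsCircuit A ω t l) {T : Set (Finset Plane)}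
    (hE : ∀ d ∈ t, t.erase d ∈ T → 0 < l d) (hR : Removable T t) :
    ∀ d ∈ t, 0 < l d → t.erase d ∈ T := by
  classical
  have hEP : (t.filter fun d => t.erase d ∈ T) ⊆ t.filter fun d => 0 < l d := fun d hd => by
    rw [Finset.mem_filter] at hd ⊢
    exact ⟨hd.1, hE d hd.1 hd.2⟩
  have hP := hl.card_pos_lt htA hc
  -- Exposed faces are among the lower ones, so it is enough to compare numbers.
  suffices h : (t.filter fun d => 0 < l d).card ≤ (t.filter fun d => t.erase d ∈ T).card by
    intro d hd hld
    have hm : d ∈ t.filter fun d => t.erase d ∈ T := by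
      rw [Finset.eq_of_subset_of_card_le hEP h]
      simp [hd, hld]
    exact (Finset.mem_filter.1 hm).2
  simp only [Removable, ncard_exposedFaces hc] at hR
  obtain ⟨h1, h2⟩ | ⟨h1, h2⟩ | h1 := hR
  -- Here `d` projects into the one exposed face, so its sign is opposite to all others, and it is
  -- the only positive one.
  · obtain ⟨d, hd⟩ := Finset.card_eq_one.1 h1
    have hd' : d ∈ t.filter fun d => t.erase d ∈ T := by simp [hd]
    rw [Finset.mem_filter] at hd'
    have hin := h2 (t.erase d) ⟨Finset.erase_subset _ _,
      by rw [Finset.card_erase_of_mem hd'.1, hc], hd'.2⟩ d hd'.1 (by simp)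
    have hs := (hl.mem_convexHull_erase_iff hA htA hc hd'.1).1 (interior_subset hin)
    rw [h1, Finset.card_le_one_iff_subset_singleton]
    refine ⟨d, fun p hp => ?_⟩
    rw [Finset.mem_filter] at hp
    by_contra hpd
    have h3 := hs p (Finset.mem_erase.2 ⟨by simpa using hpd, hp.1⟩)
    have h4 := hE d hd'.1 hd'.2
    nlinarith [hp.2]
  · rw [h1]
    by_contra! h3
    -- In convex position a negative vertex has a negative partner, which leaves at most two
    -- positive vertices.
    obtain ⟨d, hd, hn⟩ := hl.exists_neg htA hc
    obtain ⟨p, hp, hpd⟩ := (hl.convexIndependent_iff hA htA hc).1 h2 d hd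
    have h4 : (t.filter fun d => 0 < l d) ⊆ (t.erase d).erase p := fun q hq => by
      rw [Finset.mem_filter] at hq
      refine Finset.mem_erase.2 ⟨?_, Finset.mem_erase.2 ⟨?_, hq.1⟩⟩ <;> rintro rfl
      · nlinarith [hq.2]
      · linarith [hq.2]
    have h5 := Finset.card_le_card h4
    rw [Finset.card_erase_of_mem hp, Finset.card_erase_of_mem hd] at h5
    omega
  · omega

/-- A tetrahedron whose exposed faces are exactly its lower faces is removable. -/
theorem IsCircuit.removable [DecidableEq Plane] (hA : InGeneralPosition A)
    (htA : t ⊆ A) (hc : t.card = 4) (hl : IsCircuit A ω t l) {T : Set (Finset Plane)}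
    (hE : ∀ d ∈ t, t.erase d ∈ T ↔ 0 < l d) : Removable T t := by
  classical
  have hEP : (t.filter fun d => t.erase d ∈ T) = t.filter fun d => 0 < l d :=
    Finset.filter_congr hE
  have hP := hl.card_pos_lt htA hc
  have hP0 : 0 < (t.filter fun d => 0 < l d).card := by
    obtain ⟨d, hd, hld⟩ := hl.exists_pos htA hc
    exact Finset.card_pos.2 ⟨d, by simp [hd, hld]⟩
  simp only [Removable, ncard_exposedFaces hc, hEP]
  obtain h1 | h1 | h1 : (t.filter fun d => 0 < l d).card = 1 ∨
    (t.filter fun d => 0 < l d).card = 2 ∨ (t.filter fun d => 0 < l d).card = 3 := by omega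
  · refine Or.inl ⟨h1, ?_⟩
    rintro f ⟨hf, hf3, hT⟩ e het hef
    obtain ⟨d, hd, rfl⟩ := exists_eq_erase hf hf3 hc
    obtain rfl : e = d := by
      by_contra hed
      exact hef (Finset.mem_erase.2 ⟨hed, het⟩)
    have hle := (hE e hd).1 hT
    refine hl.mem_interior hA htA hc hd fun p hp => ?_
    have hpt := Finset.mem_of_mem_erase hp
    refine mul_neg_of_neg_of_pos (lt_of_le_of_ne (not_lt.1 fun hlp => ?_) (hl.ne_zero p hpt)) hle
    exact Finset.ne_of_mem_erase hp (Finset.card_le_one.1 h1.le p (by simp [hpt, hlp]) e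
      (by simp [hd, hle]))
  · refine Or.inr (Or.inl ⟨h1, (hl.convexIndependent_iff hA htA hc).2 fun d hd => ?_⟩)
    -- With signs split two and two, every vertex has a partner of its own sign.
    have h2 : (t.filter fun d => ¬ 0 < l d).card = 2 := by
      have := Finset.card_filter_add_card_filter_not (s := t) (fun d => 0 < l d)
      omega
    by_cases hld : 0 < l d
    · obtain ⟨p, hp, hpd⟩ := Finset.exists_mem_ne (by omega : 1 < _) d (s := t.filter fun d => 0 < l d)
      rw [Finset.mem_filter] at hp
      exact ⟨p, Finset.mem_erase.2 ⟨hpd, hp.1⟩, mul_pos hp.2 hld⟩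
    · obtain ⟨p, hp, hpd⟩ := Finset.exists_mem_ne (by omega : 1 < _) d
        (s := t.filter fun d => ¬ 0 < l d)
      rw [Finset.mem_filter] at hp
      exact ⟨p, Finset.mem_erase.2 ⟨hpd, hp.1⟩, mul_pos_of_neg_of_neg
        (lt_of_le_of_ne (not_lt.1 hp.2) (hl.ne_zero p hp.1))
        (lt_of_le_of_ne (not_lt.1 hld) (hl.ne_zero d hd))⟩
  · exact Or.inr (Or.inr h1)

end Flips

/-! ### Running the algorithm in either direction -/

/-- The heights as seen when flipping in the given direction. -/
def dirHeight : Direction → (Plane → ℝ) → Plane → ℝ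
  | .up, ω => ω
  | .down, ω => -ω

theorem isOldFace_iff {dir : Direction} {ω : Plane → ℝ} {t f : Finset Plane} :
    IsOldFace dir ω t f ↔ IsLowerFace (dirHeight dir ω) t f := by
  cases dir
  exacts [Iff.rfl, isLowerFace_neg.symm]

theorem isNewFace_iff {dir : Direction} {ω : Plane → ℝ} {t f : Finset Plane} :
    IsNewFace dir ω t f ↔ IsUpperFace (dirHeight dir ω) t f := by
  cases dir
  · exact Iff.rfl
  · rw [← isLowerFace_neg, dirHeight, neg_neg]; rfl

section

variable {A : Finset Plane} {ω : Plane → ℝ} {K Tu Tv : Set (Finset Plane)}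

/-- One flip of the algorithm. -/
theorem Front.step {dir : Direction} {T : SimplicialComplex ℝ Plane} {Q : Set (Finset Plane)}
    {t : Finset Plane} (h : Filling A (dirHeight dir ω) K Tu Tv)
    (hi : ∀ t ∈ tets K, AffineIndependent ℝ ((↑) : {q // q ∈ liftSimplex ω t} → Space))
    (hT : IsTriangulation A T) (hF : Front A (dirHeight dir ω) K Tv T.faces Q) (ht : t ∈ Q)
    (hR : Removable (triangles T) t) :
    ∃ T' : SimplicialComplex ℝ Plane, IsTriangulation A T' ∧
      Front A (dirHeight dir ω) K Tv T'.faces (Q \ {t}) ∧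
      performFlip (triangles T) t = triangles T' ∧ IsDirectedFlip dir ω A t T T' := by
  classical
  have hA := h.gen
  have htA := hF.subset_of_mem h ht
  have htK := hF.queue_sub ht
  have hc := htK.2
  obtain ⟨l, hl⟩ := h.exists_isCircuit htK
  have hmem : ∀ d ∈ t, t.erase d ∈ triangles T ↔ t.erase d ∈ T.faces := fun d hd =>
    ⟨fun h => h.1, fun h => ⟨h, by rw [Finset.card_erase_of_mem hd, hc]⟩⟩
  have hpos : ∀ d ∈ t, t.erase d ∈ triangles T → 0 < l d := fun d hd hT =>
    hF.pos_of_exposed h ht hl hd hT.1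
  have hlow := hl.exposed_of_removable hA htA hc hpos hR
  have hlow' : ∀ d ∈ t, 0 < l d → t.erase d ∈ T.faces := fun d hd hld => (hlow d hd hld).1
  have hF' := hF.flip h ht hl hlow'
  obtain ⟨T', hT', hT'A⟩ := hF'.tri.exists_complex
  have htri : triangles T' = (triangles T \ {f | IsOldFace dir ω t f}) ∪
      {f | IsNewFace dir ω t f} := by
    ext f
    simp only [triangles, hT', Set.mem_union, Set.mem_sdiff, Set.mem_ofPred_eq, isOldFace_iff,
      isNewFace_iff, isLowerFace_iff hA htA hc hl, isUpperFace_iff hA htA hc hl]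
    constructor
    · rintro ⟨hf, hf3⟩
      rw [mem_flipFaces_iff hA htA hc hl hF.tri hlow' hf3] at hf
      tauto
    · intro hf
      have hf3 : f.card = 3 := by
        obtain hf | ⟨d, hd, -, rfl⟩ := hf
        exacts [hf.1.2, by rw [Finset.card_erase_of_mem hd, hc]]
      rw [mem_flipFaces_iff hA htA hc hl hF.tri hlow' hf3]
      tauto
  refine ⟨T', hT'A, hT' ▸ hF', ?_, hT, hT'A, htA, hc, hi t htK, ?_, htri⟩
  -- Under the invariant the exposed faces are exactly the lower ones, hence the missing faces are
  -- the upper ones for `dirHeight dir ω`.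
  · rw [htri]
    ext f
    simp only [performFlip, exposedFaces, missingFaces, Set.mem_union, Set.mem_sdiff,
      Set.mem_ofPred_eq, isOldFace_iff, isNewFace_iff, isLowerFace_iff hA htA hc hl,
      isUpperFace_iff hA htA hc hl]
    refine or_congr (and_congr_right fun hf => not_congr ⟨?_, ?_⟩) ⟨?_, ?_⟩
    · rintro ⟨h1, h2, h3⟩
      obtain ⟨d, hd, rfl⟩ := exists_eq_erase h1 h2 hc
      exact ⟨d, hd, hpos d hd h3, rfl⟩
    · rintro ⟨d, hd, -, rfl⟩
      exact ⟨Finset.erase_subset _ _, hf.2, hf⟩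
    · rintro ⟨h1, h2, h3⟩
      obtain ⟨d, hd, rfl⟩ := exists_eq_erase h1 h2 hc
      exact ⟨d, hd, lt_of_le_of_ne (not_lt.1 fun h4 => h3 (hlow d hd h4)) (hl.ne_zero d hd), rfl⟩
    · rintro ⟨d, hd, hld, rfl⟩
      exact ⟨Finset.erase_subset _ _, by rw [Finset.card_erase_of_mem hd, hc],
        fun h4 => (hpos d hd h4).not_gt hld⟩
  · intro f hf
    rw [isOldFace_iff, isLowerFace_iff hA htA hc hl] at hf
    obtain ⟨d, hd, hld, rfl⟩ := hf
    exact hlow d hd hld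

theorem tets_finite (h : Filling A ω K Tu Tv) : (tets K).Finite :=
  (A.powerset : Set (Finset Plane)).toFinite.subset fun s hs => by simpa using h.subset s hs.1

/-- As long as tetrahedra are left, one of them is removable. -/
theorem Front.exists_removable {T : SimplicialComplex ℝ Plane} {Q : Set (Finset Plane)}
    (h : Filling A ω K Tu Tv) (hF : Front A ω K Tv T.faces Q)
    (hac : ∀ t, ¬ Relation.TransGen (Before A ω K) t t) (hQ : Q.Nonempty) :
    ∃ t ∈ Q, Removable (triangles T) t := by
  classical
  -- Acyclicity makes the transitive closure a strict order, and it is well-founded on the finite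
  -- queue. A minimal element has nothing queued in front of it.
  have : IsStrictOrder (Finset Plane) (Relation.TransGen (Before A ω K)) :=
    { irrefl := hac, trans := fun _ _ _ => Relation.TransGen.trans }
  have hwf := ((tets_finite h).subset hF.queue_sub).wellFoundedOn
    (r := Relation.TransGen (Before A ω K))
  obtain ⟨⟨t, ht⟩, -, hmin⟩ := WellFounded.has_min hwf Set.univ ⟨⟨_, hQ.some_mem⟩, trivial⟩
  obtain ⟨l, hl⟩ := h.exists_isCircuit (hF.queue_sub ht)
  have hc := (hF.queue_sub ht).2
  refine ⟨t, ht, hl.removable h.gen (hF.subset_of_mem h ht) hc fun d hd => ⟨fun h1 =>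
    hF.pos_of_exposed h ht hl hd h1.1, fun h1 => ⟨hF.exposed_of_pos h ht hl (fun s hs hst =>
      hmin ⟨s, hs⟩ trivial (Relation.TransGen.single hst)) hd h1, ?_⟩⟩⟩
  rw [Finset.card_erase_of_mem hd, hc]

/-- The algorithm, continued from any state that is a front of the filling, empties its queue. -/
theorem Front.run {dir : Direction} {Tw : SimplicialComplex ℝ Plane}
    (h : Filling A (dirHeight dir ω) K Tu Tw.faces)
    (hi : ∀ t ∈ tets K, AffineIndependent ℝ ((↑) : {q // q ∈ liftSimplex ω t} → Space))
    (hac : ∀ t, ¬ Relation.TransGen (Before A (dirHeight dir ω) K) t t) {S : ℕ → AlgState}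
    (hS : ∀ n, (S n).queue.Nonempty → LoopBody (S n) (S (n + 1))) (k : ℕ) :
    ∀ (n : ℕ) (T : SimplicialComplex ℝ Plane), IsTriangulation A T →
      Front A (dirHeight dir ω) K Tw.faces T.faces (S n).queue → (S n).current = triangles T →
      (S n).queue.ncard = k →
      ∃ (L : List (Finset Plane)) (Ts : ℕ → SimplicialComplex ℝ Plane),
        (S (n + k)).queue = ∅ ∧ (S (n + k)).output = (S n).output ++ L ∧ L.length = k ∧ L.Nodup ∧
        (∀ t, t ∈ L ↔ t ∈ (S n).queue) ∧ Ts 0 = T ∧ Ts k = Tw ∧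
        (∀ i ≤ k, IsTriangulation A (Ts i) ∧ (S (n + i)).current = triangles (Ts i)) ∧
        ∀ (i : ℕ) (hi : i < L.length), IsDirectedFlip dir ω A L[i] (Ts i) (Ts (i + 1)) := by
  -- The counter is the size of the queue: no round is idle, so exactly `k` rounds remain.
  induction k with
  | zero =>
    intro n T hT hF hcur hk
    have hfin := (tets_finite h).subset hF.queue_sub
    have hQ : (S n).queue = ∅ := (Set.ncard_eq_zero hfin).1 hk
    have hTT : T = Tw := SimplicialComplex.ext (hF.eq_of_queue_empty h hQ)
    refine ⟨[], fun _ => T, by simpa using hQ, by simp, rfl, List.nodup_nil, by simp [hQ], rfl,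
      hTT, fun i hi0 => ?_, fun i hi0 => absurd hi0 (by simp)⟩
    obtain rfl : i = 0 := by omega
    exact ⟨hT, hcur⟩
  | succ k ih =>
    intro n T hT hF hcur hk
    have hfin := (tets_finite h).subset hF.queue_sub
    have hne : (S n).queue.Nonempty := Set.nonempty_of_ncard_ne_zero (by omega)
    obtain ⟨t, ht, hR, hS'⟩ | ⟨hno, -⟩ := hS n hne
    swap
    · obtain ⟨t, ht, hR⟩ := hF.exists_removable h hac hne
      exact absurd (hcur ▸ hR) (hno t ht)
    obtain ⟨T', hT', hF', hflip, hdir⟩ := hF.step h hi hT ht (hcur ▸ hR)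
    obtain ⟨L, Ts, h1, h2, h3, h4, h5, h6, h7, h8, h9⟩ := ih (n + 1) T' hT'
      (by rw [hS']; exact hF') (by rw [hS', ← hflip, hcur])
      (by rw [hS']; simp only [Set.ncard_sdiff_singleton_of_mem ht]; omega)
    rw [hS'] at h2 h5
    have harg : ∀ i, n + (i + 1) = n + 1 + i := fun i => by omega
    refine ⟨t :: L, fun i => Nat.casesOn i T Ts, by rw [harg]; exact h1, ?_, by simp [h3], ?_, ?_,
      rfl, h7, ?_, ?_⟩
    · rw [harg, h2, List.append_assoc, List.singleton_append]
    · exact List.nodup_cons.2 ⟨fun hm => ((h5 t).1 hm).2 rfl, h4⟩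
    · intro s
      rw [List.mem_cons, h5]
      simp only [Set.mem_sdiff, Set.mem_singleton_iff]
      constructor
      · rintro (rfl | h)
        exacts [ht, h.1]
      · intro hs
        by_cases hst : s = t
        exacts [Or.inl hst, Or.inr ⟨hs, hst⟩]
    · rintro (_ | i) hik
      · exact ⟨hT, hcur⟩
      · rw [harg]
        exact h8 i (by omega)
    · rintro (_ | i) hil
      · simpa [h6] using hdir
      · simpa using h9 i (by simpa using hil)

theorem algorithmSucceeds {dir : Direction} {Ku : SimplicialComplex ℝ Space}
    {T T' : SimplicialComplex ℝ Plane} (hT : IsTriangulation A T)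
    (h : Filling A (dirHeight dir ω) (projFaces ω Ku) T.faces T'.faces)
    (hac : ∀ t, ¬ Relation.TransGen (Before A (dirHeight dir ω) (projFaces ω Ku)) t t) :
    AlgorithmSucceeds dir ω A Ku T T' := by
  rintro S ⟨h0, hS⟩
  obtain ⟨L, Ts, h1, h2, h3, h4, h5, h6, h7, h8, h9⟩ := Front.run h (fun t ht => Ku.indep ht.1) hac
    (fun n => (hS n).1) _ 0 T hT (by rw [h0, tetrahedra_eq]; exact h.front) (by rw [h0]) rfl
  have hL : (S ((S 0).queue.ncard)).output = L := by simpa [h0] using h2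
  simp only [zero_add] at h1 h8
  refine ⟨_, h1, ?_, by rw [hL, h3], by rw [hL]; exact h4, fun t => ?_, Ts, h6, h7, h8, ?_⟩
  · rw [(h8 _ le_rfl).2, h7]
  · rw [hL, h5, h0]
  · rw [hL]
    exact h9

theorem before_eq {K : SimplicialComplex ℝ Space} (hK : ∀ s ∈ projFaces ω K, s ⊆ A) :
    (fun s s' => s ∈ tetrahedra ω K ∧ s' ∈ tetrahedra ω K ∧ InFront Direction.up ω s s') =
      Before A ω (projFaces ω K) := by
  funext s t
  rw [tetrahedra_eq]
  refine propext (and_congr_right fun hs => and_congr_right fun ht => and_congr_right fun _ => ?_)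
  simp only [mem_convexHull_lift_iff (hK s hs.1), mem_convexHull_lift_iff (hK t ht.1)]
  constructor
  · rintro ⟨x, z, z', ⟨w, hw, rfl, rfl⟩, ⟨w', hw', hp, rfl⟩, hlt⟩
    exact ⟨w, w', hw, hw', hp.symm, hlt⟩
  · rintro ⟨w, w', hw, hw', hp, hlt⟩
    exact ⟨_, _, _, ⟨w, hw, rfl, rfl⟩, ⟨w', hw', hp.symm, rfl⟩, hlt⟩

theorem before_neg : Before A (-ω) K = Function.swap (Before A ω K) := by
  funext s t
  refine propext ⟨?_, ?_⟩
  · rintro ⟨hs, ht, hne, w, w', hw, hw', hp, hh⟩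
    exact ⟨ht, hs, hne.symm, w', w, hw', hw, hp.symm, by simpa [ht_neg] using hh⟩
  · rintro ⟨hs, ht, hne, w, w', hw, hw', hp, hh⟩
    exact ⟨ht, hs, hne.symm, w', w, hw', hw, hp.symm, by simpa [ht_neg] using hh⟩

/-- Acyclicity does not depend on the side from which one looks. -/
theorem hasNoCycle_down_iff {K : SimplicialComplex ℝ Space} :
    HasNoCycle Direction.down ω K ↔ HasNoCycle Direction.up ω K := by
  have : (fun s s' => s ∈ tetrahedra ω K ∧ s' ∈ tetrahedra ω K ∧ InFront Direction.down ω s s') =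
      Function.swap (fun s s' => s ∈ tetrahedra ω K ∧ s' ∈ tetrahedra ω K ∧
        InFront Direction.up ω s s') := by
    funext s t
    refine propext ⟨?_, ?_⟩
    · rintro ⟨hs, ht, hne, x, z, z', h1, h2, h3⟩
      exact ⟨ht, hs, hne.symm, x, z', z, h2, h1, h3⟩
    · rintro ⟨hs, ht, hne, x, z, z', h1, h2, h3⟩
      exact ⟨ht, hs, hne.symm, x, z', z, h2, h1, h3⟩
  simp only [HasNoCycle]
  rw [this]
  exact forall_congr' fun t => not_congr Relation.transGen_swap

end

theorem mainTheorem6 (A : Finset Plane) (hA : InGeneralPosition A) (ω : Plane → ℝ)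
    (Tu Tv : SimplicialComplex ℝ Plane)
    (hTu : IsTriangulation A Tu) (hTv : IsTriangulation A Tv)
    (hbelow : LiesBelow ω Tu Tv) (hmeet : MeetOnlyAtBoundary ω A Tu Tv)
    (Tuv : SimplicialComplex ℝ Space)
    (hTuv : IsSteinerFreeTetrahedralisation ω Tu Tv Tuv)
    (hacyclic : HasNoCycle Direction.up ω Tuv ∨ HasNoCycle Direction.down ω Tuv) :
    AlgorithmSucceeds Direction.up ω A Tuv Tu Tv ∧
      AlgorithmSucceeds Direction.down ω A Tuv Tv Tu := by
  have h := hTuv.filling hA hTu hTv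
  have hac : HasNoCycle Direction.up ω Tuv := hacyclic.elim id hasNoCycle_down_iff.1
  rw [HasNoCycle, before_eq h.subset] at hac
  -- Negating the heights reverses the in-front relation, and a cycle of the reversed relation is a
  -- cycle of the original one.
  refine ⟨algorithmSucceeds (dir := .up) hTu h hac,
    algorithmSucceeds (dir := .down) hTv h.neg fun t ht => hac t ?_⟩
  rw [dirHeight, before_neg, Relation.transGen_swap] at ht
  exact ht
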